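/- Let $G$ be a finite abelian group of order $2n$ with a fixed element $u$ of order $2$, and let $\mathbb Z\langle G\rangle=\mathbb Z[G]/(u+1)$, with involution $\overline{\sum a_\sigma\sigma}=\sum a_\sigma\sigma^{-1}$ and scaled trace $t(\sum a_\sigma\sigma)=a_1-a_u$. A $G$-lattice is a finitely generated abelian group $L$ with a symmetric positive definite bilinear form $\langle\cdot,\cdot\rangle:L\times L\to\mathbb Z$ and an action of $G$ by lattice automorphisms such that $u$ acts as $-1$; it is a $\mathbb Z\langle G\rangle$-module. Its conjugate $\overline L=\{\overline x:x\in L\}$ is the same lattice with $\sigma\overline x=\overline{\sigma^{-1}x}$, and its lifted inner product is $x\cdot\overline y=\sum_{\sigma\in S}\langle x,\sigma y\rangle\sigma\in\mathbb Z\langle G\rangle$, where $S$ is a set of coset representatives of $G/\langle u\rangle$. It is invertible if it has rank $n$, is unimodular, and for every integer $m>0$ there is $e_m\in L$ such that $\{\sigma e_m+mL:\sigma\in G\}$ generates the group $L/mL$. Let $L$ be an invertible $G$-lattice. With tensor products over $\mathbb Z\langle G\rangle$, put $L^0=\mathbb Z\langle G\rangle$, $L^m=L^{\otimes m}$ and $L^{-m}=\overline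 L^{\otimes m}$ for $m>0$. Let $\Lambda=\bigoplus_{i\in\mathbb Z}L^i$ be the extended tensor algebra, i.e. the commutative ring whose multiplication is that of tensors together with $x\,\overline y=x\cdot\overline y$ for $x\in L$, $\overline y\in\overline L$. For $m>0$ the lattice $L^m$ has inner product $\langle a,b\rangle=t(a\cdot\overline b)$, where $(x_1\otimes\cdots\otimes x_m)\cdot(\overline{y_1}\otimes\cdots\otimes\overline{y_m})=\prod_i(x_i\cdot\overline{y_i})$; a vector $a$ is short if $\langle a,a\rangle=1$. For a commutative ring $A$, let $\mu(A)$ be the group of elements of finite order of $A^*$. Let $r$ be a positive integer, let $\nu$ be a short vector of $L^r$, and let $A=\Lambda/(\nu-1)$. Then the natural map $\bigoplus_{i=0}^{r-1}L^i\to A$ is bijective and makes $A$ a $\mathbb Z/r\mathbb Z$-graded ring; the natural maps $L\to A$ and $G\to A^*$ are injective. Regarding $L$, $G$ and the $L^i$ ($0\le i<r$) as subsets of $A$, one has: (i) $G\subseteq\mu(A)\subseteq\bigcup_{i=0}^{r-1}L^i$; (ii) $\{e\in L: e\cdot\overline e=1\}=\mu(A)\cap L$; (iii) $\#\mu(A)$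 is divisible by $2n$ and divides $2nr$; (iv) there is a degree map $\mu(A)\to\mathbb Z/r\mathbb Z$ that sends $e\in\mu(A)$ to the unique $j$ with $e\in L^j$, and it is surjective if and only if $\mu(A)\cap L\neq\emptyset$; (v) there exists $e\in L$ with $e\cdot\overline e=1$ if and only if $\#\mu(A)=2nr$. -/

import Mathlib

open scoped TensorProduct DirectSum

noncomputable section

namespace ExtTensor

universe w v

variable {R : Type w} [CommRing R] {L M : Type v} [AddCommGroup L] [AddCommGroup M]
  [Module R L] [Module R M]

/-- The pieces of the extended tensor algebra: `L^{⊗ i}` for `i ≥ 0`, and `M^{⊗ (-i)}` for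
`i < 0` (in the application `M` is the conjugate of `L`). -/
def Pow (R : Type w) [CommRing R] (L M : Type v) [AddCommGroup L] [AddCommGroup M]
    [Module R L] [Module R M] : ℤ → Type (max w v)
  | Int.ofNat m => ⨂[R]^m L
  | Int.negSucc m => ⨂[R]^(m + 1) M

instance : ∀ i : ℤ, AddCommGroup (Pow R L M i)
  | Int.ofNat m => inferInstanceAs (AddCommGroup (⨂[R]^m L))
  | Int.negSucc m => inferInstanceAs (AddCommGroup (⨂[R]^(m + 1) M))

instance : ∀ i : ℤ, Module R (Pow R L M i)
  | Int.ofNat m => inferInstanceAs (Module R (⨂[R]^m L))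
  | Int.negSucc m => inferInstanceAs (Module R (⨂[R]^(m + 1) M))

/-- The underlying module of the extended tensor algebra attached to a pairing `B` of `L` and `M`:
the direct sum over all integers `i` of `Pow R L M i`. -/
def Alg (_B : L →ₗ[R] M →ₗ[R] R) : Type (max w v) := ⨁ i : ℤ, Pow R L M i

variable (B : L →ₗ[R] M →ₗ[R] R)

instance : AddCommGroup (Alg B) := inferInstanceAs (AddCommGroup (⨁ i : ℤ, Pow R L M i))
instance : Module R (Alg B) := inferInstanceAs (Module R (⨁ i : ℤ, Pow R L M i))

/-- The inclusion of `L^{⊗ m}`, `m ≥ 0`. -/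
def inPos (m : ℕ) : ⨂[R]^m L →ₗ[R] Alg B :=
  DirectSum.lof R ℤ (Pow R L M) (Int.ofNat m)

/-- The inclusion of `M^{⊗ (m + 1)}`, in degree `-(m + 1)`. -/
def inNeg (m : ℕ) : ⨂[R]^(m + 1) M →ₗ[R] Alg B :=
  DirectSum.lof R ℤ (Pow R L M) (Int.negSucc m)

/-- `cons N m x` is the map `z₁ ⊗ ⋯ ⊗ z_m ↦ x ⊗ z₁ ⊗ ⋯ ⊗ z_m`. -/
def cons (R : Type w) [CommRing R] (N : Type v) [AddCommGroup N] [Module R N] (m : ℕ) (x : N) :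
    ⨂[R]^m N →ₗ[R] ⨂[R]^(m + 1) N :=
  PiTensorProduct.lift
    ((PiTensorProduct.tprod R : MultilinearMap R (fun _ : Fin (m + 1) => N) _).curryLeft x)

/-- `contract f m` is the map `z₀ ⊗ z₁ ⊗ ⋯ ⊗ z_m ↦ f z₀ • (z₁ ⊗ ⋯ ⊗ z_m)`. -/
def contract {N : Type v} [AddCommGroup N] [Module R N] (f : N →ₗ[R] R) (m : ℕ) :
    ⨂[R]^(m + 1) N →ₗ[R] ⨂[R]^m N :=
  PiTensorProduct.lift
    (LinearMap.uncurryLeft (f.smulRight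
      (PiTensorProduct.tprod R : MultilinearMap R (fun _ : Fin m => N) _)))

/-- The unit `1`, the empty tensor in degree `0`. -/
def one : Alg B := inPos B 0 (PiTensorProduct.tprod R Fin.elim0)

/-- The linear map out of the direct sum with given components on all the pieces. -/
def lift {N : Type*} [AddCommGroup N] [Module R N] (pos : ∀ m : ℕ, ⨂[R]^m L →ₗ[R] N)
    (neg : ∀ m : ℕ, ⨂[R]^(m + 1) M →ₗ[R] N) : Alg B →ₗ[R] N :=
  DirectSum.toModule R ℤ N fun
    | Int.ofNat m => (pos m : Pow R L M (Int.ofNat m) →ₗ[R] N)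
    | Int.negSucc m => (neg m : Pow R L M (Int.negSucc m) →ₗ[R] N)

theorem lift_inPos {N : Type*} [AddCommGroup N] [Module R N] (pos : ∀ m : ℕ, ⨂[R]^m L →ₗ[R] N)
    (neg : ∀ m : ℕ, ⨂[R]^(m + 1) M →ₗ[R] N) (m : ℕ) (p : ⨂[R]^m L) :
    lift B pos neg (inPos B m p) = pos m p :=
  DirectSum.toModule_lof R (M := Pow R L M) (Int.ofNat m) p

theorem lift_inNeg {N : Type*} [AddCommGroup N] [Module R N] (pos : ∀ m : ℕ, ⨂[R]^m L →ₗ[R] N)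
    (neg : ∀ m : ℕ, ⨂[R]^(m + 1) M →ₗ[R] N) (m : ℕ) (p : ⨂[R]^(m + 1) M) :
    lift B pos neg (inNeg B m p) = neg m p :=
  DirectSum.toModule_lof R (M := Pow R L M) (Int.negSucc m) p

/-- Multiplication on the left by `x ∈ L`: it prefixes `x` to a tensor of non-negative degree, and
contracts `x` with the first factor of a tensor of negative degree. -/
def mulPosFun (x : L) : Alg B →ₗ[R] Alg B :=
  lift B (fun m => inPos B (m + 1) ∘ₗ cons R L m x) fun
    | 0 => (LinearMap.toSpanSingleton R (Alg B) (one B) ∘ₗ B x) ∘ₗ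
        (PiTensorProduct.subsingletonEquiv (0 : Fin 1)).toLinearMap
    | m + 1 => inNeg B m ∘ₗ contract (B x) (m + 1)

/-- Multiplication on the left by `y ∈ M`: it prefixes `y` to a tensor of non-positive degree, and
contracts `y` with the first factor of a tensor of positive degree. -/
def mulNegFun (y : M) : Alg B →ₗ[R] Alg B :=
  lift B (fun
    | 0 => LinearMap.toSpanSingleton R (Alg B)
          (inNeg B 0 (PiTensorProduct.tprod R fun _ => y)) ∘ₗ
        (PiTensorProduct.isEmptyEquiv (Fin 0)).toLinearMap
    | m + 1 => inPos B m ∘ₗ contract (B.flip y) m)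
    fun m => inNeg B (m + 1) ∘ₗ cons R M (m + 1) y

theorem cons_tprod {N : Type v} [AddCommGroup N] [Module R N] (m : ℕ) (x : N) (z : Fin m → N) :
    cons R N m x (PiTensorProduct.tprod R z) =
      PiTensorProduct.tprod R (Fin.cons x z : Fin (m + 1) → N) := by
  simp [cons]

theorem contract_tprod {N : Type v} [AddCommGroup N] [Module R N] (f : N →ₗ[R] R) (m : ℕ)
    (z : Fin (m + 1) → N) :
    contract f m (PiTensorProduct.tprod R z) =
      f (z 0) • PiTensorProduct.tprod R (Fin.tail z) := by
  simp [contract]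

theorem mulPosFun_pos (x : L) (m : ℕ) (z : Fin m → L) :
    mulPosFun B x (inPos B m (PiTensorProduct.tprod R z)) =
      inPos B (m + 1) (PiTensorProduct.tprod R (Fin.cons x z : Fin (m + 1) → L)) := by
  simp [mulPosFun, lift_inPos, cons_tprod]

theorem mulPosFun_neg_zero (x : L) (z : Fin 1 → M) :
    mulPosFun B x (inNeg B 0 (PiTensorProduct.tprod R z)) = B x (z 0) • one B := by
  simp [mulPosFun, lift_inNeg]

theorem mulPosFun_neg_succ (x : L) (m : ℕ) (z : Fin (m + 2) → M) :
    mulPosFun B x (inNeg B (m + 1) (PiTensorProduct.tprod R z)) =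
      B x (z 0) • inNeg B m (PiTensorProduct.tprod R (Fin.tail z)) := by
  simp [mulPosFun, lift_inNeg, contract_tprod]

theorem mulNegFun_zero (y : M) (z : Fin 0 → L) :
    mulNegFun B y (inPos B 0 (PiTensorProduct.tprod R z)) =
      inNeg B 0 (PiTensorProduct.tprod R fun _ => y) := by
  simp [mulNegFun, lift_inPos]

theorem mulNegFun_pos_succ (y : M) (m : ℕ) (z : Fin (m + 1) → L) :
    mulNegFun B y (inPos B (m + 1) (PiTensorProduct.tprod R z)) =
      B (z 0) y • inPos B m (PiTensorProduct.tprod R (Fin.tail z)) := by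
  simp [mulNegFun, lift_inPos, contract_tprod]

theorem mulNegFun_neg (y : M) (m : ℕ) (z : Fin (m + 1) → M) :
    mulNegFun B y (inNeg B m (PiTensorProduct.tprod R z)) =
      inNeg B (m + 1) (PiTensorProduct.tprod R (Fin.cons y z : Fin (m + 2) → M)) := by
  simp [mulNegFun, lift_inNeg, cons_tprod]

/-- Linear maps out of the algebra are determined by their values on pure tensors. -/
theorem hom_ext {N : Type*} [AddCommGroup N] [Module R N] {f g : Alg B →ₗ[R] N}
    (hpos : ∀ (m : ℕ) (z : Fin m → L), f (inPos B m (PiTensorProduct.tprod R z)) =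
      g (inPos B m (PiTensorProduct.tprod R z)))
    (hneg : ∀ (m : ℕ) (z : Fin (m + 1) → M), f (inNeg B m (PiTensorProduct.tprod R z)) =
      g (inNeg B m (PiTensorProduct.tprod R z))) : f = g := by
  refine DirectSum.linearMap_ext R (M := Pow R L M) fun i => ?_
  match i with
  | Int.ofNat m =>
    have h : f ∘ₗ inPos B m = g ∘ₗ inPos B m := by
      ext z
      exact hpos m z
    exact h
  | Int.negSucc m =>
    have h : f ∘ₗ inNeg B m = g ∘ₗ inNeg B m := by
      ext z
      exact hneg m z
    exact h

theorem tprod_cons_add {N : Type v} [AddCommGroup N] [Module R N] (m : ℕ) (x x' : N)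
    (z : Fin m → N) :
    PiTensorProduct.tprod R (Fin.cons (x + x') z : Fin (m + 1) → N) =
      PiTensorProduct.tprod R (Fin.cons x z : Fin (m + 1) → N) +
      PiTensorProduct.tprod R (Fin.cons x' z : Fin (m + 1) → N) :=
  ((PiTensorProduct.tprod R : MultilinearMap R (fun _ : Fin (m + 1) => N) _)).cons_add z x x'

theorem tprod_cons_smul {N : Type v} [AddCommGroup N] [Module R N] (m : ℕ) (c : R) (x : N)
    (z : Fin m → N) :
    PiTensorProduct.tprod R (Fin.cons (c • x) z : Fin (m + 1) → N) =
      c • PiTensorProduct.tprod R (Fin.cons x z : Fin (m + 1) → N) :=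
  ((PiTensorProduct.tprod R : MultilinearMap R (fun _ : Fin (m + 1) => N) _)).cons_smul z c x

theorem fin_one_add {N : Type v} [AddCommGroup N] [Module R N] (x x' : N) :
    PiTensorProduct.tprod R (fun _ : Fin 1 => x + x') =
      PiTensorProduct.tprod R (fun _ : Fin 1 => x) +
      PiTensorProduct.tprod R (fun _ : Fin 1 => x') := by
  have h (y : N) : (fun _ : Fin 1 => y) = (Fin.cons y Fin.elim0 : Fin 1 → N) := by
    ext i; fin_cases i; rfl
  simp only [h]
  exact tprod_cons_add 0 x x' _

theorem fin_one_smul {N : Type v} [AddCommGroup N] [Module R N] (c : R) (x : N) :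
    PiTensorProduct.tprod R (fun _ : Fin 1 => c • x) =
      c • PiTensorProduct.tprod R (fun _ : Fin 1 => x) := by
  have h (y : N) : (fun _ : Fin 1 => y) = (Fin.cons y Fin.elim0 : Fin 1 → N) := by
    ext i; fin_cases i; rfl
  simp only [h]
  exact tprod_cons_smul 0 c x _

/-- Left multiplication by `x ∈ L`, linearly in `x`. -/
def mulPos : L →ₗ[R] Module.End R (Alg B) where
  toFun := mulPosFun B
  map_add' x x' := by
    refine hom_ext B (fun m z => ?_) (fun m z => ?_)
    · simp [mulPosFun_pos, tprod_cons_add]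
    · cases m <;> simp [mulPosFun_neg_zero, mulPosFun_neg_succ, add_smul]
  map_smul' c x := by
    refine hom_ext B (fun m z => ?_) (fun m z => ?_)
    · simp [mulPosFun_pos, tprod_cons_smul]
    · cases m <;> simp [mulPosFun_neg_zero, mulPosFun_neg_succ, mul_smul]

/-- Left multiplication by `y ∈ M`, linearly in `y`. -/
def mulNeg : M →ₗ[R] Module.End R (Alg B) where
  toFun := mulNegFun B
  map_add' y y' := by
    refine hom_ext B (fun m z => ?_) (fun m z => ?_)
    · cases m <;> simp [mulNegFun_zero, mulNegFun_pos_succ, add_smul, fin_one_add]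
    · simp [mulNegFun_neg, tprod_cons_add]
  map_smul' c y := by
    refine hom_ext B (fun m z => ?_) (fun m z => ?_)
    · cases m <;> simp [mulNegFun_zero, mulNegFun_pos_succ, mul_smul, fin_one_smul]
    · simp [mulNegFun_neg, tprod_cons_smul]

theorem mulPos_apply (x : L) (p : Alg B) : mulPos B x p = mulPosFun B x p := rfl
theorem mulNeg_apply (y : M) (p : Alg B) : mulNeg B y p = mulNegFun B y p := rfl

/-- Left multiplication by an arbitrary element: a pure tensor `z₁ ⊗ ⋯ ⊗ z_m`, of positive or of
negative degree, acts as the composition of the left multiplications by `z₁, …, z_m`. -/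
def act : Alg B →ₗ[R] Module.End R (Alg B) :=
  lift B
    (fun m => PiTensorProduct.lift
      ((MultilinearMap.mkPiAlgebraFin R m (Module.End R (Alg B))).compLinearMap
        fun _ => mulPos B))
    (fun m => PiTensorProduct.lift
      ((MultilinearMap.mkPiAlgebraFin R (m + 1) (Module.End R (Alg B))).compLinearMap
        fun _ => mulNeg B))

theorem act_pos (m : ℕ) (z : Fin m → L) :
    act B (inPos B m (PiTensorProduct.tprod R z)) =
      (List.ofFn fun i => mulPos B (z i)).prod := by
  rw [act, lift_inPos, PiTensorProduct.lift.tprod]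
  rfl

theorem act_neg (m : ℕ) (z : Fin (m + 1) → M) :
    act B (inNeg B m (PiTensorProduct.tprod R z)) =
      (List.ofFn fun i => mulNeg B (z i)).prod := by
  rw [act, lift_inNeg, PiTensorProduct.lift.tprod]
  rfl

instance : One (Alg B) := ⟨one B⟩
instance : Mul (Alg B) := ⟨fun p q => act B p q⟩

theorem one_def : (1 : Alg B) = inPos B 0 (PiTensorProduct.tprod R Fin.elim0) := rfl
theorem mul_def (p q : Alg B) : p * q = act B p q := rfl

theorem act_one : act B 1 = 1 := by
  rw [one_def, act_pos]; simp

theorem act_apply_one (p : Alg B) : act B p 1 = p := by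
  have h : (LinearMap.applyₗ (1 : Alg B)) ∘ₗ act B = LinearMap.id := by
    refine hom_ext B (fun m z => ?_) (fun m z => ?_)
    · simp only [LinearMap.comp_apply, LinearMap.applyₗ_apply_apply, act_pos, LinearMap.id_apply]
      induction m with
      | zero => simp [one_def, Subsingleton.elim z Fin.elim0]
      | succ m ih =>
        rw [List.ofFn_succ, List.prod_cons, Module.End.mul_apply, ih fun i => z i.succ]
        exact (mulPosFun_pos B _ _ _).trans
          (by rw [show (Fin.cons (z 0) fun i => z i.succ) = z from Fin.cons_self_tail z])
    · simp only [LinearMap.comp_apply, LinearMap.applyₗ_apply_apply, act_neg, LinearMap.id_apply]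
      induction m with
      | zero =>
        simp only [List.ofFn_succ, List.ofFn_zero, List.prod_cons, List.prod_nil, mul_one]
        refine (mulNegFun_zero B _ _).trans ?_
        congr 2
        ext i; fin_cases i; rfl
      | succ m ih =>
        rw [List.ofFn_succ, List.prod_cons, Module.End.mul_apply, ih fun i => z i.succ]
        exact (mulNegFun_neg B _ _ _).trans
          (by rw [show (Fin.cons (z 0) fun i => z i.succ) = z from Fin.cons_self_tail z])
  exact LinearMap.congr_fun h p

/-- Two elements `e`, `e'` that generate submodules of `N` of coprime exponents `d`, `d'`. -/
def NearlyCyclic (R : Type w) [CommRing R] (N : Type v) [AddCommGroup N] [Module R N] : Prop :=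
  ∃ d d' : ℤ, IsCoprime d d' ∧ (∃ e : N, ∀ x : N, ∃ a : R, d • x = a • e) ∧
    ∃ e : N, ∀ x : N, ∃ a : R, d' • x = a • e

theorem NearlyCyclic.alternating {N : Type v} [AddCommGroup N] [Module R N]
    (h : NearlyCyclic R N) {P : Type*} [AddCommGroup P] [Module R P] (f : N →ₗ[R] N →ₗ[R] P)
    (hf : ∀ x, f x x = 0) (x y : N) : f x y = 0 := by
  have key (d : ℤ) (hd : ∃ e : N, ∀ x : N, ∃ a : R, d • x = a • e) : (d * d) • f x y = 0 := by
    obtain ⟨e, he⟩ := hd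
    obtain ⟨a, ha⟩ := he x
    obtain ⟨b, hb⟩ := he y
    have : f (d • x) (d • y) = (d * d) • f x y := by
      rw [map_zsmul, map_zsmul, LinearMap.smul_apply, smul_smul]
    rw [← this, ha, hb]
    simp [hf]
  obtain ⟨d, d', hc, h1, h2⟩ := h
  obtain ⟨s, t, hst⟩ := (hc.mul_left hc).mul_right (hc.mul_left hc)
  rw [← one_smul ℤ (f x y), ← hst, add_smul, mul_smul s, mul_smul t, key d h1, key d' h2]
  simp

variable {B}

theorem swapL (hL : NearlyCyclic R L) (x z : L) (y : M) : B x y • z = B z y • x := by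
  have := hL.alternating
    ((LinearMap.lsmul R L).comp (B.flip y) - ((LinearMap.lsmul R L).comp (B.flip y)).flip)
    (fun x => by simp) x z
  simpa [sub_eq_zero] using this

theorem swapM (hM : NearlyCyclic R M) (x : L) (y z : M) : B x y • z = B x z • y := by
  have := hM.alternating
    ((LinearMap.lsmul R M).comp (B x) - ((LinearMap.lsmul R M).comp (B x)).flip)
    (fun x => by simp) y z
  simpa [sub_eq_zero] using this

theorem mulPos_comm (hL : NearlyCyclic R L) (x z : L) :
    mulPos B x * mulPos B z = mulPos B z * mulPos B x := by
  have := hL.alternating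
    ((LinearMap.mul R (Module.End R (Alg B))).compl₁₂ (mulPos B) (mulPos B) -
      ((LinearMap.mul R (Module.End R (Alg B))).compl₁₂ (mulPos B) (mulPos B)).flip)
    (fun x => by simp) x z
  simpa [sub_eq_zero] using this

theorem mulNeg_comm (hM : NearlyCyclic R M) (x z : M) :
    mulNeg B x * mulNeg B z = mulNeg B z * mulNeg B x := by
  have := hM.alternating
    ((LinearMap.mul R (Module.End R (Alg B))).compl₁₂ (mulNeg B) (mulNeg B) -
      ((LinearMap.mul R (Module.End R (Alg B))).compl₁₂ (mulNeg B) (mulNeg B)).flip)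
    (fun x => by simp) x z
  simpa [sub_eq_zero] using this

theorem mulPos_mulNeg (hL : NearlyCyclic R L) (x : L) (y : M) :
    mulPos B x * mulNeg B y = B x y • 1 := by
  refine hom_ext B (fun m z => ?_) (fun m z => ?_)
  · simp only [Module.End.mul_apply, LinearMap.smul_apply, Module.End.one_apply, mulPos_apply,
      mulNeg_apply]
    cases m with
    | zero =>
      rw [mulNegFun_zero, mulPosFun_neg_zero, Subsingleton.elim z Fin.elim0]
      rfl
    | succ m =>
      rw [mulNegFun_pos_succ, map_smul, mulPosFun_pos, ← map_smul, ← tprod_cons_smul,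
        ← swapL hL x (z 0) y, tprod_cons_smul, map_smul, Fin.cons_self_tail]
  · simp only [Module.End.mul_apply, LinearMap.smul_apply, Module.End.one_apply, mulPos_apply,
      mulNeg_apply]
    rw [mulNegFun_neg, mulPosFun_neg_succ]
    simp

theorem mulNeg_mulPos (hM : NearlyCyclic R M) (x : L) (y : M) :
    mulNeg B y * mulPos B x = B x y • 1 := by
  refine hom_ext B (fun m z => ?_) (fun m z => ?_)
  · simp only [Module.End.mul_apply, LinearMap.smul_apply, Module.End.one_apply, mulPos_apply,
      mulNeg_apply]
    rw [mulPosFun_pos, mulNegFun_pos_succ]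
    simp
  · simp only [Module.End.mul_apply, LinearMap.smul_apply, Module.End.one_apply, mulPos_apply,
      mulNeg_apply]
    cases m with
    | zero =>
      rw [mulPosFun_neg_zero, map_smul]
      change _ • mulNegFun B y (inPos B 0 _) = _
      rw [mulNegFun_zero, ← map_smul, ← fin_one_smul, ← swapM hM x y (z 0), fin_one_smul,
        map_smul]
      rw [show (fun _ : Fin 1 => z 0) = z by ext i; fin_cases i; rfl]
    | succ m =>
      rw [mulPosFun_neg_succ, map_smul, mulNegFun_neg, ← map_smul, ← tprod_cons_smul,
        ← swapM hM x y (z 0), tprod_cons_smul, map_smul, Fin.cons_self_tail]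

theorem act_mulPos (hL : NearlyCyclic R L) (x : L) (q : Alg B) :
    act B (mulPos B x q) = mulPos B x * act B q := by
  have h : act B ∘ₗ mulPos B x = (LinearMap.mulLeft R (mulPos B x)) ∘ₗ act B := by
    refine hom_ext B (fun m z => ?_) (fun m z => ?_)
    · simp only [LinearMap.comp_apply, LinearMap.mulLeft_apply, mulPos_apply]
      rw [mulPosFun_pos, act_pos, act_pos, List.ofFn_succ, List.prod_cons]
      simp
    · simp only [LinearMap.comp_apply, LinearMap.mulLeft_apply, mulPos_apply]
      cases m with
      | zero =>
        rw [mulPosFun_neg_zero, map_smul, act_neg, List.ofFn_succ, List.prod_cons, ← mul_assoc,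
          mulPos_mulNeg hL]
        change _ • act B 1 = _
        simp [act_one]
      | succ m =>
        rw [mulPosFun_neg_succ, map_smul, act_neg, act_neg, List.ofFn_succ (n := m + 1),
          List.prod_cons, ← mul_assoc, mulPos_mulNeg hL, smul_mul_assoc, one_mul]
        rfl
  exact LinearMap.congr_fun h q

theorem act_mulNeg (hM : NearlyCyclic R M) (y : M) (q : Alg B) :
    act B (mulNeg B y q) = mulNeg B y * act B q := by
  have h : act B ∘ₗ mulNeg B y = (LinearMap.mulLeft R (mulNeg B y)) ∘ₗ act B := by
    refine hom_ext B (fun m z => ?_) (fun m z => ?_)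
    · simp only [LinearMap.comp_apply, LinearMap.mulLeft_apply, mulNeg_apply]
      cases m with
      | zero =>
        rw [mulNegFun_zero, act_neg, act_pos]
        simp
      | succ m =>
        rw [mulNegFun_pos_succ, map_smul, act_pos, act_pos, List.ofFn_succ,
          List.prod_cons, ← mul_assoc, mulNeg_mulPos hM, smul_mul_assoc, one_mul]
        rfl
    · simp only [LinearMap.comp_apply, LinearMap.mulLeft_apply, mulNeg_apply]
      rw [mulNegFun_neg, act_neg, act_neg, List.ofFn_succ, List.prod_cons]
      simp
  exact LinearMap.congr_fun h q

/-- A property of operators that holds for the left multiplications by elements of `L` and of `M`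
and that defines a subalgebra holds for all left multiplications. -/
theorem act_induction (S : Subalgebra R (Module.End R (Alg B)))
    (hpos : ∀ x, mulPos B x ∈ S) (hneg : ∀ y, mulNeg B y ∈ S) (p : Alg B) : act B p ∈ S := by
  have h : (Subalgebra.toSubmodule S).mkQ ∘ₗ act B = 0 := by
    refine hom_ext B (fun m z => ?_) (fun m z => ?_)
    · simp only [LinearMap.comp_apply, LinearMap.zero_apply, act_pos, Submodule.mkQ_apply,
        Submodule.Quotient.mk_eq_zero, Subalgebra.mem_toSubmodule]
      refine Subalgebra.list_prod_mem S fun f hf => ?_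
      obtain ⟨i, rfl⟩ := (List.mem_ofFn' _ _).1 hf
      exact hpos _
    · simp only [LinearMap.comp_apply, LinearMap.zero_apply, act_neg, Submodule.mkQ_apply,
        Submodule.Quotient.mk_eq_zero, Subalgebra.mem_toSubmodule]
      refine Subalgebra.list_prod_mem S fun f hf => ?_
      obtain ⟨i, rfl⟩ := (List.mem_ofFn' _ _).1 hf
      exact hneg _
  simpa using LinearMap.congr_fun h p

theorem act_act (hL : NearlyCyclic R L) (hM : NearlyCyclic R M) (p q : Alg B) :
    act B (act B p q) = act B p * act B q := by
  let S : Subalgebra R (Module.End R (Alg B)) :=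
    { carrier := {f | ∀ q, act B (f q) = f * act B q}
      mul_mem' := fun {f g} hf hg q => by
        rw [Module.End.mul_apply, hf, hg, mul_assoc]
      add_mem' := fun {f g} hf hg q => by
        rw [LinearMap.add_apply, map_add, hf, hg, add_mul]
      algebraMap_mem' := fun c q => by
        simp [Module.algebraMap_end_apply, Algebra.smul_def] }
  exact act_induction S (act_mulPos hL) (act_mulNeg hM) p q

theorem act_commute (hL : NearlyCyclic R L) (hM : NearlyCyclic R M) (p q : Alg B) :
    act B p * act B q = act B q * act B p := by
  have hx (x : L) : act B q * mulPos B x = mulPos B x * act B q := by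
    have := act_induction (Subalgebra.centralizer R {mulPos B x})
      (fun z => by simp [Subalgebra.mem_centralizer_iff, mulPos_comm hL x z])
      (fun y => by simp [Subalgebra.mem_centralizer_iff, mulPos_mulNeg hL, mulNeg_mulPos hM]) q
    simpa [Subalgebra.mem_centralizer_iff, eq_comm] using this
  have hy (y : M) : act B q * mulNeg B y = mulNeg B y * act B q := by
    have := act_induction (Subalgebra.centralizer R {mulNeg B y})
      (fun y => by simp [Subalgebra.mem_centralizer_iff, mulPos_mulNeg hL, mulNeg_mulPos hM])
      (fun z => by simp [Subalgebra.mem_centralizer_iff, mulNeg_comm hM y z]) q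
    simpa [Subalgebra.mem_centralizer_iff, eq_comm] using this
  have := act_induction (Subalgebra.centralizer R {act B q})
    (fun x => by simp [Subalgebra.mem_centralizer_iff, hx])
    (fun y => by simp [Subalgebra.mem_centralizer_iff, hy]) p
  simpa [Subalgebra.mem_centralizer_iff, eq_comm] using this

/-- The ring structure of the extended tensor algebra. -/
abbrev commRing (hL : NearlyCyclic R L) (hM : NearlyCyclic R M) : CommRing (Alg B) :=
  { (inferInstance : AddCommGroup (Alg B)), (inferInstance : One (Alg B)),
    (inferInstance : Mul (Alg B)) with
    one_mul := fun p => by rw [mul_def, act_one]; rfl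
    mul_one := fun p => act_apply_one B p
    zero_mul := fun p => by rw [mul_def, map_zero]; rfl
    mul_zero := fun p => by rw [mul_def, map_zero]
    left_distrib := fun p q r => by simp only [mul_def, map_add]
    right_distrib := fun p q r => by simp only [mul_def, map_add, LinearMap.add_apply]
    mul_assoc := fun p q r => by
      simp only [mul_def, act_act hL hM, Module.End.mul_apply]
    mul_comm := fun p q => by
      have h := LinearMap.congr_fun (act_commute hL hM p q) 1
      simpa only [Module.End.mul_apply, act_apply_one, mul_def] using h }

/-- The extended tensor algebra is an algebra over `R`. -/
abbrev algebra (hL : NearlyCyclic R L) (hM : NearlyCyclic R M) :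
    letI := commRing (B := B) hL hM
    Algebra R (Alg B) :=
  letI := commRing (B := B) hL hM
  Algebra.ofModule (fun c p q => by
      change act B (c • p) q = c • act B p q
      rw [map_smul, LinearMap.smul_apply])
    (fun c p q => map_smul (act B p) c q)

end ExtTensor

/-- The modified group ring `ℤ⟨G⟩ = ℤ[G] / (u + 1)`. -/
def ModGroupRing {G : Type*} [CommGroup G] (u : G) : Type _ :=
  MonoidAlgebra ℤ G ⧸ Ideal.span {MonoidAlgebra.of ℤ G u + 1}

namespace ModGroupRing

variable {G : Type*} [CommGroup G] {u : G}

instance : CommRing (ModGroupRing u) :=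
  inferInstanceAs (CommRing (MonoidAlgebra ℤ G ⧸ Ideal.span {MonoidAlgebra.of ℤ G u + 1}))

/-- The quotient map `ℤ[G] → ℤ⟨G⟩`. -/
def mk (u : G) : MonoidAlgebra ℤ G →+* ModGroupRing u :=
  Ideal.Quotient.mk (Ideal.span {MonoidAlgebra.of ℤ G u + 1})

theorem mk_surjective : Function.Surjective (mk u) := Ideal.Quotient.mk_surjective

/-- The map `G → ℤ⟨G⟩`. -/
def of (u : G) : G →* ModGroupRing u := (mk u : _ →* _).comp (MonoidAlgebra.of ℤ G)

theorem of_self : of u u = -1 := by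
  have : mk u (MonoidAlgebra.of ℤ G u + 1) = 0 :=
    Ideal.Quotient.eq_zero_iff_mem.2 (Ideal.subset_span rfl)
  rw [map_add, map_one] at this
  exact eq_neg_of_add_eq_zero_left this

theorem of_self_mul (σ : G) : of u (u * σ) = -of u σ := by
  rw [map_mul, of_self, neg_one_mul]

@[elab_as_elim]
theorem induction {motive : ModGroupRing u → Prop} (a : ModGroupRing u)
    (of : ∀ σ, motive (of u σ)) (add : ∀ a b, motive a → motive b → motive (a + b))
    (neg : ∀ a, motive a → motive (-a)) (zero : motive 0) : motive a := by
  obtain ⟨a, rfl⟩ := mk_surjective a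
  induction a using MonoidAlgebra.induction_on with
  | of σ => exact of σ
  | add x y hx hy => rw [map_add]; exact add _ _ hx hy
  | smul r x hx =>
    rw [map_zsmul]
    induction r with
    | zero => simpa using zero
    | succ i ih => rw [add_smul, one_smul]; exact add _ _ ih hx
    | pred i ih => rw [sub_smul, one_smul, sub_eq_add_neg]; exact add _ _ ih (neg _ hx)

/-- Ring homomorphisms out of `ℤ⟨G⟩`. -/
def lift {S : Type*} [Ring S] (f : G →* S) (hf : f u = -1) : ModGroupRing u →+* S :=
  Ideal.Quotient.lift _ (MonoidAlgebra.lift ℤ S G f).toRingHom (by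
    intro a ha
    have : Ideal.span {MonoidAlgebra.of ℤ G u + 1} ≤
        RingHom.ker (MonoidAlgebra.lift ℤ S G f).toRingHom := by
      rw [Ideal.span_le, Set.singleton_subset_iff]
      simp [RingHom.mem_ker, hf]
    exact this ha)

theorem lift_of {S : Type*} [Ring S] (f : G →* S) (hf : f u = -1) (σ : G) :
    lift f hf (of u σ) = f σ :=
  (Ideal.Quotient.lift_mk _ _ _).trans (MonoidAlgebra.lift_of f σ)

/-- The involution `∑ a_σ σ ↦ ∑ a_σ σ⁻¹` of `ℤ⟨G⟩`. -/
def bar (u : G) : ModGroupRing u →+* ModGroupRing u :=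
  lift ((of u).comp (invMonoidHom : G →* G)) (by
    have h : of u u⁻¹ * of u u = 1 := by rw [← map_mul, inv_mul_cancel, map_one]
    rw [of_self, mul_neg, mul_one] at h
    exact neg_eq_iff_eq_neg.1 h)

theorem bar_of (σ : G) : bar u (of u σ) = of u σ⁻¹ := lift_of _ _ σ

theorem bar_bar (a : ModGroupRing u) : bar u (bar u a) = a := by
  induction a using induction with
  | of σ => rw [bar_of, bar_of, inv_inv]
  | add a b ha hb => rw [map_add, map_add, ha, hb]
  | neg a ha => rw [map_neg, map_neg, ha]
  | zero => rw [map_zero, map_zero]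

/-- The scaled trace function `t (∑ a_σ σ) = a_1 - a_u`. -/
def trace (u : G) [hu : Fact (orderOf u = 2)] : ModGroupRing u →+ ℤ :=
  QuotientAddGroup.lift (Ideal.span {MonoidAlgebra.of ℤ G u + 1}).toAddSubgroup
    { toFun := fun a : MonoidAlgebra ℤ G => a.coeff 1 - a.coeff u
      map_zero' := by simp
      map_add' := fun a b => by simp; ring } (by
    intro a ha
    obtain ⟨b, rfl⟩ := Ideal.mem_span_singleton'.1 ha
    have hu2 : u * u = 1 := by rw [← sq, ← hu.out, pow_orderOf_eq_one]
    have hu' : u⁻¹ = u := inv_eq_of_mul_eq_one_left hu2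
    simp [mul_add, MonoidAlgebra.of_apply, hu', hu2, add_comm])

theorem trace_of [Fact (orderOf u = 2)] [DecidableEq G] (σ : G) :
    trace u (of u σ) = (if σ = 1 then 1 else 0) - if σ = u then 1 else 0 := by
  change (MonoidAlgebra.of ℤ G σ).coeff 1 - (MonoidAlgebra.of ℤ G σ).coeff u = _
  simp [MonoidAlgebra.of_apply, Finsupp.single_apply]

end ModGroupRing

/-- The conjugate `N̄` of a module `N` over `ℤ⟨G⟩`: the same additive group, with the action of
`ℤ⟨G⟩` composed with the involution, so that `σ x̄` is the conjugate of `σ⁻¹ x`. -/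
def Conj (N : Type*) : Type _ := N

namespace Conj

variable {G : Type*} [CommGroup G] {u : G} {N : Type*} [AddCommGroup N]

instance : AddCommGroup (Conj N) := inferInstanceAs (AddCommGroup N)

/-- The bijection `x ↦ x̄` from `N` to its conjugate. -/
def conj : N ≃+ Conj N := AddEquiv.refl N

instance [Module (ModGroupRing u) N] : Module (ModGroupRing u) (Conj N) :=
  Module.compHom N (ModGroupRing.bar u)

theorem smul_conj [Module (ModGroupRing u) N] (a : ModGroupRing u) (x : N) :
    a • conj x = conj (ModGroupRing.bar u a • x) := rfl

theorem conj_smul [Module (ModGroupRing u) N] (a : ModGroupRing u) (x : N) :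
    conj (a • x) = ModGroupRing.bar u a • conj x := by
  rw [smul_conj, ModGroupRing.bar_bar]

end Conj

open Conj (conj)

/-- An integral lattice: a finitely generated abelian group with an integer valued symmetric
positive definite bilinear form. -/
class IntegralLattice (L : Type*) [AddCommGroup L] where
  finite : Module.Finite ℤ L
  form : L →ₗ[ℤ] L →ₗ[ℤ] ℤ
  symm : ∀ x y, form x y = form y x
  pos : ∀ x, x ≠ 0 → 0 < form x x

/-- A `G`-lattice: an integral lattice on which `G` acts by automorphisms, with `u` acting
as `-1`. -/
class GLattice {G : Type*} [CommGroup G] (u : G) (L : Type*) [AddCommGroup L] [IntegralLattice L]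
    [DistribMulAction G L] : Prop where
  form_smul : ∀ (σ : G) (x y : L),
    IntegralLattice.form (σ • x) (σ • y) = IntegralLattice.form x y
  smul_eq_neg : ∀ x : L, u • x = -x

namespace GLattice

open IntegralLattice

variable {G : Type*} [CommGroup G] (u : G) (L : Type*) [AddCommGroup L] [IntegralLattice L]
  [DistribMulAction G L]

/-- A `G`-lattice is a module over `ℤ⟨G⟩`. -/
instance [GLattice u L] : Module (ModGroupRing u) L :=
  Module.compHom L (ModGroupRing.lift (u := u) (DistribMulAction.toModuleEnd ℤ L) (by
    ext x
    exact smul_eq_neg x) : ModGroupRing u →+* Module.End ℤ L)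

theorem of_smul [GLattice u L] (σ : G) (x : L) : ModGroupRing.of u σ • x = σ • x := by
  change ModGroupRing.lift (u := u) (DistribMulAction.toModuleEnd ℤ L)
    (by ext x; exact smul_eq_neg x) (ModGroupRing.of u σ) x = _
  rw [ModGroupRing.lift_of]
  rfl

/-- A `G`-lattice is invertible if its rank is half of the order of `G`, it is unimodular, and for
every positive integer `m` there is an `e` in `L` such that the classes of `σ e`, `σ ∈ G`,
generate the abelian group `L / m L`. -/
class IsInvertible [GLattice u L] : Prop where
  rank : Module.finrank ℤ L = Nat.card G / 2
  unimodular : Function.Bijective (form : L →ₗ[ℤ] Module.Dual ℤ L)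
  generates : ∀ m : ℕ, 0 < m → ∃ e : L, AddSubgroup.closure
    (Set.range fun σ : G => (QuotientAddGroup.mk (σ • e) : L ⧸ (nsmulAddMonoidHom m : L →+ L).range))
      = ⊤

variable {L} in
/-- The conjugation `x₁ ⊗ ⋯ ⊗ x_m ↦ x̄₁ ⊗ ⋯ ⊗ x̄_m`, viewed as a linear map from `L^{⊗ m}` to the
conjugate module of `L̄^{⊗ m}`. -/
def tensorConjHom [GLattice u L] (m : ℕ) : ⨂[ModGroupRing u]^m L →ₗ[ModGroupRing u]
    Conj (⨂[ModGroupRing u]^m (Conj L)) :=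
  PiTensorProduct.lift
    { toFun := fun x => conj (PiTensorProduct.tprod _ fun i => conj (x i))
      map_update_add' := fun x i y y' => by
        have h (z : L) : (fun j => conj (Function.update x i z j)) =
            Function.update (fun j => conj (x j)) i (conj z) := by
          ext j; rcases eq_or_ne j i with rfl | hj <;> simp [*]
        simp only [h, map_add, MultilinearMap.map_update_add]
      map_update_smul' := fun x i a y => by
        have h (z : L) : (fun j => conj (Function.update x i z j)) =
            Function.update (fun j => conj (x j)) i (conj z) := by
          ext j; rcases eq_or_ne j i with rfl | hj <;> simp [*]
        simp only [h, Conj.conj_smul, MultilinearMap.map_update_smul, ModGroupRing.bar_bar] }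

variable {L} in
/-- The conjugation `L^{⊗ m} → L̄^{⊗ m}`, `x₁ ⊗ ⋯ ⊗ x_m ↦ x̄₁ ⊗ ⋯ ⊗ x̄_m`. -/
def tensorConj [GLattice u L] (m : ℕ) (a : ⨂[ModGroupRing u]^m L) : ⨂[ModGroupRing u]^m (Conj L) :=
  conj.symm (tensorConjHom u m a)

variable {L} in
theorem tensorConj_tprod [GLattice u L] (m : ℕ) (x : Fin m → L) :
    tensorConj u m (PiTensorProduct.tprod _ x) =
      PiTensorProduct.tprod _ fun i => conj (x i) := by
  rw [tensorConj, tensorConjHom, PiTensorProduct.lift.tprod]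
  rfl

section Lifted

variable {L} [Finite G] [GLattice u L]

/-- The term `⟨x, σ y⟩ σ` as a function of `σ ∈ G / ⟨u⟩`. -/
def liftedTerm (x y : L) : G ⧸ Subgroup.zpowers u → ModGroupRing u :=
  Quotient.lift (fun σ : G => form x (σ • y) • ModGroupRing.of u σ) (by
    intro σ τ h
    obtain ⟨k, hk⟩ := Subgroup.mem_zpowers_iff.1 (QuotientGroup.leftRel_apply.1 h)
    obtain rfl : τ = u ^ k * σ := by rw [hk]; simp [mul_comm]
    clear hk h
    have step (ρ : G) : form x ((u * ρ) • y) • ModGroupRing.of u (u * ρ) =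
        form x (ρ • y) • ModGroupRing.of u ρ := by
      rw [ModGroupRing.of_self_mul, mul_smul, smul_eq_neg, map_neg, neg_smul, smul_neg, neg_neg]
    induction k with
    | zero => simp
    | succ i ih => rw [add_comm, zpow_add, zpow_one, mul_assoc]; exact ih.trans (step _).symm
    | pred i ih =>
      have := step (u ^ (-(i : ℤ) - 1) * σ)
      rw [← mul_assoc, ← zpow_one_add, add_sub_cancel] at this
      exact ih.trans this)

/-- The lifted inner product `x · ȳ = ∑_{σ ∈ S} ⟨x, σ y⟩ σ`, where `S` is a set of coset
representatives of `G / ⟨u⟩`. -/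
def liftedInner (x y : L) : ModGroupRing u :=
  letI := Fintype.ofFinite (G ⧸ Subgroup.zpowers u)
  ∑ q : G ⧸ Subgroup.zpowers u, liftedTerm u x y q

theorem liftedInner_add_left (x x' y : L) :
    liftedInner u (x + x') y = liftedInner u x y + liftedInner u x' y := by
  rw [liftedInner, liftedInner, liftedInner, ← Finset.sum_add_distrib]
  refine Finset.sum_congr rfl fun q _ => ?_
  induction q using QuotientGroup.induction_on with
  | H σ =>
    change form (x + x') (σ • y) • _ = form x (σ • y) • _ + form x' (σ • y) • _
    rw [map_add, LinearMap.add_apply, add_smul]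

theorem liftedInner_add_right (x y y' : L) :
    liftedInner u x (y + y') = liftedInner u x y + liftedInner u x y' := by
  rw [liftedInner, liftedInner, liftedInner, ← Finset.sum_add_distrib]
  refine Finset.sum_congr rfl fun q _ => ?_
  induction q using QuotientGroup.induction_on with
  | H σ =>
    change form x (σ • (y + y')) • _ = form x (σ • y) • _ + form x (σ • y') • _
    rw [smul_add, map_add, add_smul]

theorem liftedInner_of_smul_left (σ : G) (x y : L) :
    liftedInner u (σ • x) y = ModGroupRing.of u σ * liftedInner u x y := by
  rw [liftedInner, liftedInner, Finset.mul_sum]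
  let _ := Fintype.ofFinite (G ⧸ Subgroup.zpowers u)
  refine (Fintype.sum_equiv (Equiv.mulLeft (σ : G ⧸ Subgroup.zpowers u)) _ _ fun q => ?_).symm
  induction q using QuotientGroup.induction_on with
  | H τ =>
    change _ * form x (τ • y) • ModGroupRing.of u τ =
      form (σ • x) ((σ * τ) • y) • ModGroupRing.of u (σ * τ)
    rw [mul_smul, form_smul (u := u), map_mul, mul_smul_comm]

theorem liftedInner_of_smul_right (σ : G) (x y : L) :
    liftedInner u x (σ • y) = ModGroupRing.of u σ⁻¹ * liftedInner u x y := by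
  rw [← liftedInner_of_smul_left, liftedInner, liftedInner]
  refine Finset.sum_congr rfl fun q _ => ?_
  induction q using QuotientGroup.induction_on with
  | H τ =>
    change form x (τ • σ • y) • _ = form (σ⁻¹ • x) (τ • y) • _
    rw [← form_smul (u := u) σ (σ⁻¹ • x), smul_inv_smul, smul_smul, smul_smul, mul_comm]

theorem liftedInner_smul_left (a : ModGroupRing u) (x y : L) :
    liftedInner u (a • x) y = a * liftedInner u x y := by
  let f : L →+ ModGroupRing u := AddMonoidHom.mk' (fun x => liftedInner u x y)
    fun x x' => liftedInner_add_left u x x' y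
  change f (a • x) = a * f x
  induction a using ModGroupRing.induction with
  | of σ => rw [of_smul]; exact liftedInner_of_smul_left u σ x y
  | add a b ha hb => rw [add_smul, map_add, ha, hb, add_mul]
  | neg a ha => rw [neg_smul, map_neg, ha, neg_mul]
  | zero => rw [zero_smul, map_zero, zero_mul]

theorem liftedInner_smul_right (a : ModGroupRing u) (x y : L) :
    liftedInner u x (a • y) = ModGroupRing.bar u a * liftedInner u x y := by
  let f : L →+ ModGroupRing u := AddMonoidHom.mk' (fun y => liftedInner u x y)
    fun y y' => liftedInner_add_right u x y y'
  change f (a • y) = _ * f y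
  induction a using ModGroupRing.induction with
  | of σ => rw [of_smul, ModGroupRing.bar_of]; exact liftedInner_of_smul_right u σ x y
  | add a b ha hb => rw [add_smul, map_add, ha, hb, map_add, add_mul]
  | neg a ha => rw [neg_smul, map_neg, ha, map_neg, neg_mul]
  | zero => rw [zero_smul, map_zero, map_zero, zero_mul]

variable (L) in
/-- The lifted inner product as a `ℤ⟨G⟩`-bilinear map `L × L̄ → ℤ⟨G⟩`. -/
def dot : L →ₗ[ModGroupRing u] Conj L →ₗ[ModGroupRing u] ModGroupRing u :=
  LinearMap.mk₂ (ModGroupRing u) (fun x y => liftedInner u x (conj.symm y))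
    (fun x x' y => liftedInner_add_left u x x' _)
    (fun a x y => liftedInner_smul_left u a x _)
    (fun x y y' => by rw [map_add, liftedInner_add_right])
    (fun a x y => by
      obtain ⟨y, rfl⟩ := conj.surjective y
      rw [Conj.smul_conj, AddEquiv.symm_apply_apply, AddEquiv.symm_apply_apply,
        liftedInner_smul_right, ModGroupRing.bar_bar]
      rfl)

/-- The lifted inner product `L^{⊗ m} × L̄^{⊗ m} → ℤ⟨G⟩`, given by
`(x₁ ⊗ ⋯ ⊗ x_m) · (ȳ₁ ⊗ ⋯ ⊗ ȳ_m) = ∏ (x_i · ȳ_i)`. -/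
def tensorDot (m : ℕ) : ⨂[ModGroupRing u]^m L →ₗ[ModGroupRing u]
    ⨂[ModGroupRing u]^m (Conj L) →ₗ[ModGroupRing u] ModGroupRing u :=
  TensorPower.pairingDual (ModGroupRing u) (Conj L) m ∘ₗ PiTensorProduct.map fun _ => dot u L

theorem tensorDot_tprod (m : ℕ) (x : Fin m → L) (y : Fin m → Conj L) :
    tensorDot u m (PiTensorProduct.tprod _ x) (PiTensorProduct.tprod _ y) =
      ∏ i, dot u L (x i) (y i) := by
  rw [tensorDot, LinearMap.comp_apply, PiTensorProduct.map_tprod,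
    TensorPower.pairingDual_tprod_tprod]

/-- The inner product `⟨a, b⟩ = t (a · b̄)` of the `G`-lattice `L^{⊗ m}`. -/
def tensorForm [Fact (orderOf u = 2)] (m : ℕ) (a b : ⨂[ModGroupRing u]^m L) : ℤ :=
  ModGroupRing.trace u (tensorDot u m a (tensorConj u m b))

/-- A vector of the lattice `L^{⊗ m}` is short if its inner product with itself is `1`. -/
def IsShort [Fact (orderOf u = 2)] {m : ℕ} (a : ⨂[ModGroupRing u]^m L) : Prop :=
  tensorForm u m a a = 1

end Lifted

theorem exists_coprime_smul [GLattice u L] [IsInvertible u L] (m : ℕ) (hm : 0 < m) :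
    ∃ d : ℤ, (m : ℤ) ∣ d - 1 ∧ ∃ e : L, ∀ x : L, ∃ a : ModGroupRing u, d • x = a • e := by
  obtain ⟨e, he⟩ := IsInvertible.generates (u := u) (L := L) m hm
  have := IntegralLattice.finite (L := L)
  let N : Submodule ℤ L := AddSubgroup.toIntSubmodule
    (LinearMap.toSpanSingleton (ModGroupRing u) L e).toAddMonoidHom.range
  have hN (σ : G) : σ • e ∈ N := ⟨ModGroupRing.of u σ, of_smul u L σ e⟩
  have key (x : L) : ∃ y : L, x - m • y ∈ N := by
    have hx : (QuotientAddGroup.mk x : L ⧸ (nsmulAddMonoidHom m : L →+ L).range) ∈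
      AddSubgroup.closure (Set.range fun σ : G =>
        (QuotientAddGroup.mk (σ • e) : L ⧸ (nsmulAddMonoidHom m : L →+ L).range)) := by
      rw [he]; trivial
    have hle : AddSubgroup.closure (Set.range fun σ : G =>
        (QuotientAddGroup.mk (σ • e) : L ⧸ (nsmulAddMonoidHom m : L →+ L).range)) ≤
        N.toAddSubgroup.map (QuotientAddGroup.mk' _) := by
      rw [AddSubgroup.closure_le]
      rintro _ ⟨σ, rfl⟩
      exact ⟨σ • e, hN σ, rfl⟩
    obtain ⟨z, hz, hzx⟩ := hle hx
    obtain ⟨y, hy⟩ := QuotientAddGroup.eq.1 hzx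
    refine ⟨y, ?_⟩
    have : x - m • y = z := by
      have hy' : m • y = -z + x := hy
      rw [hy']; abel
    rw [this]; exact hz
  obtain ⟨d, hd, hdN⟩ := Submodule.exists_sub_one_mem_and_smul_eq_zero_of_fg_of_le_smul
    (Ideal.span {(m : ℤ)}) (⊤ : Submodule ℤ (L ⧸ N)) Module.Finite.fg_top (by
      rintro q -
      obtain ⟨x, rfl⟩ := N.mkQ_surjective q
      obtain ⟨y, hy⟩ := key x
      have : N.mkQ x = (m : ℤ) • N.mkQ y := by
        rw [← map_smul, ← sub_eq_zero, ← map_sub, Submodule.mkQ_apply,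
          Submodule.Quotient.mk_eq_zero, natCast_zsmul]
        exact hy
      rw [this]
      exact Submodule.smul_mem_smul (Ideal.mem_span_singleton_self _) trivial)
  refine ⟨d, Ideal.mem_span_singleton.1 hd, e, fun x => ?_⟩
  have hx := hdN (N.mkQ x) trivial
  rw [← map_smul, Submodule.mkQ_apply, Submodule.Quotient.mk_eq_zero] at hx
  obtain ⟨a, ha⟩ := hx
  exact ⟨a, ha.symm⟩

theorem nearlyCyclic [GLattice u L] [IsInvertible u L] :
    ExtTensor.NearlyCyclic (ModGroupRing u) L := by
  obtain ⟨d, hd, h⟩ := exists_coprime_smul u L 2 two_pos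
  have hd0 : d ≠ 0 := by
    rintro rfl
    norm_num at hd
  obtain ⟨d', hd', h'⟩ := exists_coprime_smul u L d.natAbs (Int.natAbs_pos.2 hd0)
  refine ⟨d, d', ?_, h, h'⟩
  obtain ⟨k, hk⟩ := Int.natAbs_dvd.1 hd'
  exact ⟨-k, 1, by linear_combination hk⟩

theorem nearlyCyclic_conj [GLattice u L] [IsInvertible u L] :
    ExtTensor.NearlyCyclic (ModGroupRing u) (Conj L) := by
  have key (d : ℤ) (h : ∃ e : L, ∀ x : L, ∃ a : ModGroupRing u, d • x = a • e) :
      ∃ e : Conj L, ∀ x : Conj L, ∃ a : ModGroupRing u, d • x = a • e := by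
    obtain ⟨e, he⟩ := h
    refine ⟨conj e, fun x => ?_⟩
    obtain ⟨x, rfl⟩ := conj.surjective x
    obtain ⟨a, ha⟩ := he x
    exact ⟨ModGroupRing.bar u a, by rw [← Conj.conj_smul, ← ha, map_zsmul]⟩
  obtain ⟨d, d', hc, h, h'⟩ := nearlyCyclic u L
  exact ⟨d, d', hc, key d h, key d' h'⟩

variable [Finite G] [GLattice u L]

/-- The extended tensor algebra `Λ = ⨁ L^{⊗ i}`, `i ∈ ℤ`, where `L^{⊗ (-m)} = L̄^{⊗ m}`. Its
multiplication is that of tensors, together with the lifted inner product `L × L̄ → ℤ⟨G⟩`. -/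
def ExtAlg : Type _ := ExtTensor.Alg (dot u L)

instance [IsInvertible u L] : CommRing (ExtAlg u L) :=
  ExtTensor.commRing (B := dot u L) (nearlyCyclic u L) (nearlyCyclic_conj u L)

instance [IsInvertible u L] : Algebra (ModGroupRing u) (ExtAlg u L) :=
  ExtTensor.algebra (B := dot u L) (nearlyCyclic u L) (nearlyCyclic_conj u L)

variable [IsInvertible u L]

/-- The inclusion of `L^{⊗ m}`, `m ≥ 0`, in the extended tensor algebra. -/
def incl (m : ℕ) : ⨂[ModGroupRing u]^m L →ₗ[ModGroupRing u] ExtAlg u L :=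
  ExtTensor.inPos (dot u L) m

/-- The inclusion of `L̄^{⊗ (m + 1)}` in the extended tensor algebra. -/
def inclConj (m : ℕ) : ⨂[ModGroupRing u]^(m + 1) (Conj L) →ₗ[ModGroupRing u] ExtAlg u L :=
  ExtTensor.inNeg (dot u L) m

theorem incl_zero (a : ModGroupRing u) :
    incl u L 0 (a • PiTensorProduct.tprod _ Fin.elim0) = algebraMap _ (ExtAlg u L) a := by
  rw [map_smul, Algebra.algebraMap_eq_smul_one]
  rfl

theorem incl_mul_incl (m : ℕ) (x : L) (z : Fin m → L) :
    incl u L 1 (PiTensorProduct.tprod _ fun _ => x) * incl u L m (PiTensorProduct.tprod _ z) =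
      incl u L (m + 1) (PiTensorProduct.tprod _ (Fin.cons x z : Fin (m + 1) → L)) := by
  change ExtTensor.act (dot u L) (ExtTensor.inPos _ _ _) (ExtTensor.inPos _ _ _) = _
  rw [ExtTensor.act_pos]
  simp [ExtTensor.mulPos_apply, ExtTensor.mulPosFun_pos]
  rfl

theorem inclConj_mul_inclConj (m : ℕ) (y : Conj L) (z : Fin (m + 1) → Conj L) :
    inclConj u L 0 (PiTensorProduct.tprod _ fun _ => y) *
      inclConj u L m (PiTensorProduct.tprod _ z) =
      inclConj u L (m + 1) (PiTensorProduct.tprod _ (Fin.cons y z : Fin (m + 2) → Conj L)) := by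
  change ExtTensor.act (dot u L) (ExtTensor.inNeg _ _ _) (ExtTensor.inNeg _ _ _) = _
  rw [ExtTensor.act_neg]
  simp [ExtTensor.mulNeg_apply, ExtTensor.mulNegFun_neg]
  rfl

theorem incl_mul_inclConj (x : L) (y : Conj L) :
    incl u L 1 (PiTensorProduct.tprod _ fun _ => x) *
      inclConj u L 0 (PiTensorProduct.tprod _ fun _ => y) = algebraMap _ _ (dot u L x y) := by
  change ExtTensor.act (dot u L) (ExtTensor.inPos _ _ _) (ExtTensor.inNeg _ _ _) = _
  rw [ExtTensor.act_pos, Algebra.algebraMap_eq_smul_one]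
  simp [ExtTensor.mulPos_apply, ExtTensor.mulPosFun_neg_zero]
  rfl

variable {L} {r : ℕ} (ν : ⨂[ModGroupRing u]^r L)

/-- The ring `A = Λ / (ν - 1)`. -/
abbrev RootRing : Type _ := ExtAlg u L ⧸ Ideal.span {incl u L r ν - 1}

/-- The natural map `L^{⊗ i} → A`, for `i ≥ 0`. -/
def toRootRing (i : ℕ) : ⨂[ModGroupRing u]^i L →ₗ[ModGroupRing u] RootRing u ν :=
  (Ideal.Quotient.mkₐ (ModGroupRing u) (Ideal.span {incl u L r ν - 1})).toLinearMap ∘ₗ incl u L i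

/-- The natural map `⨁_{0 ≤ i < r} L^{⊗ i} → A`. -/
def sumToRootRing : (⨁ i : Fin r, ⨂[ModGroupRing u]^(i : ℕ) L) →ₗ[ModGroupRing u] RootRing u ν :=
  DirectSum.toModule (ModGroupRing u) (Fin r) _ fun i => toRootRing u ν i

/-- The natural map `L → A`. -/
def latticeToRootRing : L →ₗ[ModGroupRing u] RootRing u ν :=
  toRootRing u ν 1 ∘ₗ 
    (PiTensorProduct.subsingletonEquiv (R := ModGroupRing u) (s := fun _ : Fin 1 => L)
      0).symm.toLinearMap

/-- The piece of degree `j ∈ ℤ/rℤ` of `A`: the image of `L^{⊗ i}`, where `0 ≤ i < r` represents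
`j` (for `r > 0`). -/
def piece (j : ZMod r) : Submodule (ModGroupRing u) (RootRing u ν) :=
  LinearMap.range (toRootRing u ν j.val)

/-- The natural map `G → A^*`. -/
def groupToUnits : G →* (RootRing u ν)ˣ :=
  MonoidHom.toHomUnits
    (((algebraMap (ModGroupRing u) (RootRing u ν) : _ →* _)).comp (ModGroupRing.of u))

end GLattice

/-- The group `μ(A)` of roots of unity of a commutative ring: the units of finite order. -/
abbrev rootsOfUnityGroup (A : Type*) [CommRing A] : Subgroup Aˣ := CommGroup.torsion Aˣ

end

open GLattice

/-! Write R for ℤ⟨G⟩. Everything happens in the commutative ring Λ, which is ℤ-graded with R in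
degree zero and carries an involution p ↦ p̄ (`star`) that exchanges L and L̄ and reverses degrees.
For a and b in L^m the lifted product a · b̄ is just the product a b̄ in Λ (`algebraMap_tensorDot`),
so inner products are traces of products.

Invertibility enters twice. First, the lifted inner products generate the unit ideal of R
(`span_dot_eq_top`), so 1 lies in L^m L^{-m} for every m, and questions about L^m can be moved to
degree zero. Second, up to an odd integer d the module L is generated by one vector f, and L^m by
f^m. With w = f · f̄ the norm form on L^m becomes, up to a positive factor, t(c c̄ w^m). Even powers
of w are absorbed in c, and one leftover w turns it into a norm in L, so the form is positive
definite (`tr_mul_star_posDef`).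

A short vector v even satisfies v v̄ = 1 (`mul_star_eq_one`). Indeed v ± σv has norm 2 ± 2 t(v v̄
σ), so t(v v̄ σ) = 0 unless σv = ±v, and a divisibility argument shows that the latter happens only
for σ in {1, u} (`card_signStabilizer_dvd`).

Hence ν is a unit of degree r, and A is Λ with degrees folded modulo r. The involution descends to
A, and so does the trace that first shifts degrees divisible by r to zero by powers of ν
(`periodicTrace`). In the resulting form on A the pieces of degrees 0, ..., r - 1 are orthogonal and
positive definite, which shows that they embed and are independent. A root of unity ζ has ζ ζ̄ = 1
(`toQuot_mul_star_eq_one`); the trace 1 is a sum of nonnegative integers, one for each degree, so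
only one component survives (`exists_homogeneous`). Conversely, if a is homogeneous with a ā = 1,
then a^r can be shifted to degree zero, where elements of norm one come from G, so a has finite
order (`isOfFinOrder_toQuot`). So the degree map on μ(A) has kernel G, and #μ(A) is 2n times the
order of its image. That image is all of ℤ/rℤ exactly when it contains 1, that is, when L has a
vector of lifted norm one. -/

namespace ModGroupRing

/-! ### The scaled trace and the positive definite form t(a ā) on ℤ⟨G⟩. -/

variable {G : Type*} [CommGroup G] {u : G}

theorem self_ne_one [hu : Fact (orderOf u = 2)] : u ≠ 1 := by
  rintro rfl
  simpa using hu.out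

theorem self_mul_self [hu : Fact (orderOf u = 2)] : u * u = 1 := by
  rw [← sq, ← hu.out, pow_orderOf_eq_one]

theorem of_mul_of_inv (σ : G) : of u σ * of u σ⁻¹ = 1 := by
  rw [← map_mul, mul_inv_cancel, map_one]

variable [Fact (orderOf u = 2)]

theorem trace_one : trace u 1 = 1 := by
  classical
  rw [← map_one (of u), trace_of]
  simp [(self_ne_one (u := u)).symm]

theorem trace_of_eq_zero {σ : G} (h1 : σ ≠ 1) (h2 : σ ≠ u) : trace u (of u σ) = 0 := by
  classical
  rw [trace_of]
  simp [h1, h2]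

theorem of_injective : Function.Injective (of u) := by
  classical
  rw [injective_iff_map_eq_one]
  intro σ h
  by_contra h1
  have h2 := trace_of (u := u) σ
  rw [h, trace_one] at h2
  rw [if_neg h1] at h2
  split_ifs at h2 <;> omega

theorem trace_bar (a : ModGroupRing u) : trace u (bar u a) = trace u a := by
  induction a using induction with
  | of σ =>
    classical
    have h : u⁻¹ = u := inv_eq_of_mul_eq_one_left self_mul_self
    rw [bar_of, trace_of, trace_of]
    simp [inv_eq_iff_eq_inv, h]
  | add a b ha hb => simp only [map_add, ha, hb]
  | neg a ha => simp only [map_neg, ha]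
  | zero => simp

theorem trace_mul_of_self (a : ModGroupRing u) : trace u (a * of u u) = -trace u a := by
  rw [of_self, mul_neg, mul_one, map_neg]

/-- The coefficient of σ is t(a σ⁻¹), and σ and uσ contribute the same term since both factors
change sign. Summing over all of G counts each coset of ⟨u⟩ twice, which accounts for the factor 2
and avoids a choice of representatives. -/
theorem two_smul_eq_sum [Fintype G] (a : ModGroupRing u) :
    (2 : ℤ) • a = ∑ σ : G, trace u (a * of u σ⁻¹) • of u σ := by
  induction a using induction with
  | of τ =>
    classical
    have h (σ : G) : trace u (of u τ * of u σ⁻¹) • of u σ =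
        (if σ = τ then of u τ else 0) + if σ = u * τ then of u τ else 0 := by
      rw [← map_mul, trace_of]
      have h1 : τ * σ⁻¹ = 1 ↔ σ = τ := by rw [mul_inv_eq_one, eq_comm]
      have h2 : τ * σ⁻¹ = u ↔ σ = u * τ := by
        rw [mul_inv_eq_iff_eq_mul]
        constructor
        · rintro rfl; rw [← mul_assoc, self_mul_self, one_mul]
        · rintro rfl; rw [← mul_assoc, self_mul_self, one_mul]
      simp only [h1, h2, sub_smul]
      have h3 : τ ≠ u * τ := fun h => self_ne_one (u := u) (by simpa using h.symm)
      by_cases e1 : σ = τ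
      · subst e1; simp [h3]
      · by_cases e2 : σ = u * τ
        · subst e2; simp [h3.symm, of_self_mul]
        · simp [e1, e2]
    simp only [h, Finset.sum_add_distrib, Finset.sum_ite_eq', Finset.mem_univ, if_true, two_smul]
  | add a b ha hb => simp only [smul_add, ha, hb, add_mul, map_add, add_smul, Finset.sum_add_distrib]
  | neg a ha => simp only [smul_neg, ha, neg_mul, map_neg, neg_smul, Finset.sum_neg_distrib]
  | zero => simp

theorem trace_mk_smul_eq (a : ModGroupRing u) (σ : G) (k : ℤ) :
    trace u (a * of u (σ * u ^ k)⁻¹) • of u (σ * u ^ k) = trace u (a * of u σ⁻¹) • of u σ := by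
  have step (ρ : G) : trace u (a * of u (u * ρ)⁻¹) • of u (u * ρ) =
      trace u (a * of u ρ⁻¹) • of u ρ := by
    have h : u⁻¹ = u := inv_eq_of_mul_eq_one_left self_mul_self
    rw [of_self_mul, mul_inv, h, of_self_mul]
    simp
  rcases Int.even_or_odd k with ⟨m, rfl⟩ | ⟨m, rfl⟩
  · rw [← two_mul, zpow_mul, zpow_two, self_mul_self]; simp
  · rw [zpow_add, zpow_mul, zpow_two, self_mul_self, one_zpow, one_mul, zpow_one, mul_comm σ]
    exact step σ

/-- Every element of `ℤ⟨G⟩` is a combination of coset representatives of `G / ⟨u⟩`. -/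
theorem eq_sum_out [Fintype (G ⧸ Subgroup.zpowers u)] (a : ModGroupRing u) :
    a = ∑ q : G ⧸ Subgroup.zpowers u, trace u (a * of u q.out⁻¹) • of u q.out := by
  induction a using induction with
  | of τ =>
    classical
    rw [Finset.sum_eq_single (τ : G ⧸ Subgroup.zpowers u)]
    · obtain ⟨⟨_, k, rfl⟩, hk⟩ := QuotientGroup.mk_out_eq_mul (Subgroup.zpowers u) τ
      rw [hk]
      change _ = trace u (of u τ * of u (τ * u ^ k)⁻¹) • of u (τ * u ^ k)
      rw [trace_mk_smul_eq, of_mul_of_inv, trace_one, one_smul]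
    · intro q _ hq
      rw [← map_mul, trace_of_eq_zero, zero_smul]
      · intro h
        apply hq
        rw [mul_inv_eq_one] at h
        rw [h, QuotientGroup.out_eq']
      · intro h
        apply hq
        rw [mul_inv_eq_iff_eq_mul] at h
        conv_lhs => rw [← QuotientGroup.out_eq' q]
        rw [QuotientGroup.eq, h, mul_comm u, inv_mul_cancel_left]
        exact Subgroup.mem_zpowers u
    · simp
  | add a b ha hb =>
    simp only [add_mul, map_add, add_smul, Finset.sum_add_distrib]
    rw [← ha, ← hb]
  | neg a ha =>
    simp only [neg_mul, map_neg, neg_smul, Finset.sum_neg_distrib]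
    rw [← ha]
  | zero => simp

/-- The traces of the translates are the coefficients. Most identities in ℤ⟨G⟩ below are checked
this way. -/
theorem ext_trace [Finite G] {a b : ModGroupRing u}
    (h : ∀ σ, trace u (a * of u σ) = trace u (b * of u σ)) :
    a = b := by
  have := Fintype.ofFinite (G ⧸ Subgroup.zpowers u)
  rw [eq_sum_out a, eq_sum_out b]
  exact Finset.sum_congr rfl fun q _ => by rw [h]

theorem two_mul_trace_mul [Fintype G] (a b : ModGroupRing u) :
    2 * trace u (a * b) = ∑ σ : G, trace u (a * of u σ⁻¹) * trace u (b * of u σ) := by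
  have h : (2 : ℤ) • (a * b) = ∑ σ : G, trace u (a * of u σ⁻¹) • (b * of u σ) := by
    rw [← smul_mul_assoc, two_smul_eq_sum, Finset.sum_mul]
    exact Finset.sum_congr rfl fun σ _ => by rw [smul_mul_assoc, mul_comm b]
  have := congrArg (trace u) h
  simpa only [map_zsmul, map_sum, smul_eq_mul] using this

/-- So t(a ā) is the sum of the squares of the coefficients over G / ⟨u⟩, hence positive definite.
-/
theorem two_mul_trace_mul_bar [Fintype G] (a : ModGroupRing u) :
    2 * trace u (a * bar u a) = ∑ σ : G, trace u (a * of u σ⁻¹) ^ 2 := by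
  rw [two_mul_trace_mul]
  refine Finset.sum_congr rfl fun σ _ => ?_
  rw [← trace_bar (bar u a * _), (bar u).map_mul, bar_bar, bar_of, sq]

variable [Finite G]

theorem trace_mul_bar_nonneg (a : ModGroupRing u) : 0 ≤ trace u (a * bar u a) := by
  have := Fintype.ofFinite G
  have h := two_mul_trace_mul_bar a
  have : 0 ≤ ∑ σ : G, trace u (a * of u σ⁻¹) ^ 2 := Finset.sum_nonneg fun _ _ => sq_nonneg _
  omega

theorem eq_zero_of_trace_mul_bar {a : ModGroupRing u} (h : trace u (a * bar u a) = 0) : a = 0 := by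
  have := Fintype.ofFinite G
  have h2 := two_mul_trace_mul_bar a
  rw [h, mul_zero, eq_comm, Finset.sum_eq_zero_iff_of_nonneg fun _ _ => sq_nonneg _] at h2
  refine ext_trace fun σ => ?_
  have := h2 σ⁻¹ (Finset.mem_univ _)
  rw [inv_inv] at this
  rw [pow_eq_zero_iff two_ne_zero |>.1 this, zero_mul, map_zero]

theorem eq_zero_of_zsmul_eq_zero {k : ℤ} (hk : k ≠ 0) {a : ModGroupRing u} (h : k • a = 0) :
    a = 0 := by
  refine ext_trace fun σ => ?_
  have := congrArg (fun b => trace u (b * of u σ)) h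
  simp only [smul_mul_assoc, map_zsmul, zero_mul, map_zero, smul_eq_mul, mul_eq_zero, hk,
    false_or] at this
  rw [this, zero_mul, map_zero]

/-- An element of trace norm `1` comes from the group. -/
theorem exists_of_eq {g : ModGroupRing u} (h : trace u (g * bar u g) = 1) : ∃ σ, of u σ = g := by
  -- Replacing σ by σu changes the sign of the coefficient. If no coefficient were positive, all
  -- would vanish and g would be 0.
  have hpos : ∃ σ, 0 < trace u (g * of u σ⁻¹) := by
    by_contra! hneg
    have hz (σ : G) : trace u (g * of u σ) = 0 := by
      have h1 := hneg σ⁻¹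
      have h2 := hneg (σ * u)⁻¹
      rw [inv_inv] at h1 h2
      rw [(of u).map_mul, ← mul_assoc, trace_mul_of_self] at h2
      omega
    have : g = 0 := ext_trace fun σ => by rw [hz, zero_mul, map_zero]
    simp [this] at h
  obtain ⟨σ, hσ⟩ := hpos
  refine ⟨σ, (sub_eq_zero.1 (eq_zero_of_trace_mul_bar (le_antisymm ?_
    (trace_mul_bar_nonneg _)))).symm⟩
  -- The norm of g - σ is 1 - 2 t(g σ⁻¹) + 1, which is at most 0 because t(g σ⁻¹) is a positive
  -- integer.
  have h1 : (g - of u σ) * bar u (g - of u σ) =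
      g * bar u g - g * of u σ⁻¹ - bar u (g * of u σ⁻¹) + of u σ * of u σ⁻¹ := by
    simp only [map_sub, map_mul, bar_of, inv_inv]
    ring
  rw [h1, map_add, map_sub, map_sub, trace_bar, of_mul_of_inv, trace_one, h]
  omega

end ModGroupRing

/-- A function on a finite group that is invariant under a subgroup has sum divisible by the order
of the subgroup. -/
theorem Subgroup.card_dvd_sum_of_forall_mul_eq {G : Type*} [Group G] [Fintype G] (K : Subgroup G)
    (F : G → ℤ) (hF : ∀ k ∈ K, ∀ g, F (g * k) = F g) : (Nat.card K : ℤ) ∣ ∑ g, F g := by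
  have := Fintype.ofFinite K
  have := Fintype.ofFinite (G ⧸ K)
  have hb : Function.Bijective fun p : (G ⧸ K) × K => p.1.out * (p.2 : G) := by
    refine ⟨?_, fun g => ?_⟩
    · rintro ⟨q, k⟩ ⟨q', k'⟩ h
      have hq : q = q' := by
        have := congrArg (QuotientGroup.mk : G → G ⧸ K) h
        simpa using this
      subst hq
      simpa using h
    · obtain ⟨k, hk⟩ := QuotientGroup.mk_out_eq_mul K g
      exact ⟨((g : G ⧸ K), k⁻¹), by simp [hk]⟩
  rw [← hb.sum_comp, Fintype.sum_prod_type]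
  refine Finset.dvd_sum fun q _ => ?_
  simp [fun k : K => hF k k.2]

namespace GLattice

open IntegralLattice
open Conj (conj)

/-! ### The lifted inner product recovers the form and is Hermitian. -/

section Pairing

variable {G : Type*} [CommGroup G] (u : G) {L : Type*} [AddCommGroup L] [IntegralLattice L]
  [DistribMulAction G L] [Finite G] [GLattice u L]

variable [Fact (orderOf u = 2)]

theorem trace_liftedInner (x y : L) : ModGroupRing.trace u (liftedInner u x y) = form x y := by
  rw [liftedInner, map_sum, Finset.sum_eq_single ((1 : G) : G ⧸ Subgroup.zpowers u)]
  · change ModGroupRing.trace u (form x ((1 : G) • y) • ModGroupRing.of u 1) = _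
    rw [map_one, map_zsmul, ModGroupRing.trace_one, one_smul, smul_eq_mul, mul_one]
  · intro q _ hq
    induction q using QuotientGroup.induction_on with
    | H σ =>
      change ModGroupRing.trace u (form x (σ • y) • ModGroupRing.of u σ) = 0
      rw [map_zsmul, ModGroupRing.trace_of_eq_zero, smul_zero]
      · rintro rfl; exact hq rfl
      · rintro rfl
        refine hq (QuotientGroup.eq.2 ?_)
        rw [mul_one, inv_mem_iff]
        exact Subgroup.mem_zpowers σ
  · simp

/-- Compare traces of translates: G acts by isometries and the form is symmetric. -/
theorem bar_liftedInner (x y : L) :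
    ModGroupRing.bar u (liftedInner u x y) = liftedInner u y x := by
  refine ModGroupRing.ext_trace fun σ => ?_
  rw [← ModGroupRing.trace_bar, map_mul, ModGroupRing.bar_bar, ModGroupRing.bar_of, mul_comm,
    mul_comm _ (ModGroupRing.of u σ), ← liftedInner_of_smul_left, ← liftedInner_of_smul_left,
    trace_liftedInner, trace_liftedInner, ← form_smul (u := u) σ (σ⁻¹ • x), smul_inv_smul,
    IntegralLattice.symm]

theorem trace_dot (x y : L) : ModGroupRing.trace u (dot u L x (conj y)) = form x y :=
  trace_liftedInner u x y

theorem bar_dot (x y : L) :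
    ModGroupRing.bar u (dot u L x (conj y)) = dot u L y (conj x) := bar_liftedInner u x y

end Pairing

instance finite_modGroupRing {G : Type*} [CommGroup G] [Finite G] (u : G) :
    Module.Finite ℤ (ModGroupRing u) :=
  Module.Finite.of_surjective (ModGroupRing.mk u).toAddMonoidHom.toIntLinearMap
    ModGroupRing.mk_surjective

/-! ### The lifted pairing is perfect: its values generate the unit ideal. -/

section Perfect

/-- Every σe lies in ℤ⟨G⟩e, so the generation condition says that L = ℤ⟨G⟩e + mL. -/
theorem exists_generator_mod {G : Type*} [CommGroup G] (u : G) (L : Type*) [AddCommGroup L]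
    [IntegralLattice L] [DistribMulAction G L] [GLattice u L] [IsInvertible u L] (m : ℕ) (hm : 0 < m) :
    ∃ e : L, ∀ x : L, ∃ (a : ModGroupRing u) (y : L), x = a • e + m • y := by
  obtain ⟨e, he⟩ := IsInvertible.generates (u := u) (L := L) m hm
  refine ⟨e, fun x => ?_⟩
  let N : AddSubgroup L := (LinearMap.toSpanSingleton (ModGroupRing u) L e).toAddMonoidHom.range
  have hle : AddSubgroup.closure (Set.range fun σ : G =>
      (QuotientAddGroup.mk (σ • e) : L ⧸ (nsmulAddMonoidHom m : L →+ L).range)) ≤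
      N.map (QuotientAddGroup.mk' _) := by
    rw [AddSubgroup.closure_le]
    rintro _ ⟨σ, rfl⟩
    exact ⟨σ • e, ⟨ModGroupRing.of u σ, of_smul u L σ e⟩, rfl⟩
  obtain ⟨_, ⟨a, rfl⟩, hzx⟩ := hle (he ▸ AddSubgroup.mem_top (QuotientAddGroup.mk x))
  obtain ⟨y, hy⟩ := QuotientAddGroup.eq.1 hzx
  refine ⟨a, y, ?_⟩
  have hy' : m • y = -(a • e) + x := hy
  rw [hy']
  abel

theorem isTorsionFree (L : Type*) [AddCommGroup L] [IntegralLattice L] :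
     Module.IsTorsionFree ℤ L := by
  refine Module.IsTorsionFree.of_smul_eq_zero fun k x h => ?_
  by_contra! hne
  have := IntegralLattice.pos x hne.2
  have h2 : k * form x x = 0 := by
    rw [← smul_eq_mul, ← LinearMap.smul_apply, ← map_smul, h, map_zero, LinearMap.zero_apply]
  rcases mul_eq_zero.1 h2 with h3 | h3
  · exact hne.1 h3
  · omega

/-- The functional ⟨x, ·⟩ / m is integral, so by unimodularity it is represented by a vector z, and
x = mz. -/
theorem eq_nsmul_of_form {L : Type*} [AddCommGroup L] [IntegralLattice L]
    (hL : Function.Bijective (form : L →ₗ[ℤ] Module.Dual ℤ L)) {m : ℕ} (hm : 0 < m) (x : L)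
    (hx : ∀ y, (m : ℤ) ∣ form x y) :
    ∃ y : L, x = m • y := by
  have hm0 : (m : ℤ) ≠ 0 := by exact_mod_cast hm.ne'
  let φ : Module.Dual ℤ L := (AddMonoidHom.mk' (fun y => form x y / m) fun y y' => by
    rw [map_add, Int.add_ediv_of_dvd_left (hx y)]).toIntLinearMap
  obtain ⟨z, hz⟩ := hL.2 φ
  refine ⟨z, hL.1 ?_⟩
  ext y
  rw [map_nsmul, hz]
  change form x y = (m • φ) y
  rw [LinearMap.smul_apply]
  change _ = m • (form x y / m)
  rw [nsmul_eq_mul, Int.mul_ediv_cancel' (hx y)]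

variable {G : Type*} [CommGroup G] [Finite G] (u : G) [Fact (orderOf u = 2)] (L : Type*)
  [AddCommGroup L] [IntegralLattice L] [DistribMulAction G L] [GLattice u L] [IsInvertible u L]

/-- Here the rank n is used. Modulo m, the map a ↦ ae from ℤ⟨G⟩ to L is onto, and ℤ⟨G⟩ needs no more
additive generators than L has rank. The map is therefore injective modulo m. -/
theorem mem_of_smul_mem {m : ℕ} {e : L}
    (he : ∀ x : L, ∃ (a : ModGroupRing u) (y : L), x = a • e + m • y) (a : ModGroupRing u) (y : L)
    (ha : a • e = m • y) : ∃ b : ModGroupRing u, a = m • b := by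
  have := Fintype.ofFinite (G ⧸ Subgroup.zpowers u)
  have hfin := IntegralLattice.finite (L := L)
  have htf := isTorsionFree L
  have hfree : Module.Free ℤ L := inferInstance
  let s : (G ⧸ Subgroup.zpowers u → ℤ) →ₗ[ℤ] ModGroupRing u :=
    Fintype.linearCombination ℤ fun q => ModGroupRing.of u q.out
  have hs : Function.Surjective s := fun a =>
    ⟨fun q => ModGroupRing.trace u (a * ModGroupRing.of u q.out⁻¹), by
      rw [Fintype.linearCombination_apply]
      exact (ModGroupRing.eq_sum_out a).symm⟩
  have hcard : Module.finrank ℤ L = Module.finrank ℤ (G ⧸ Subgroup.zpowers u → ℤ) := by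
    rw [IsInvertible.rank (u := u), Module.finrank_fintype_fun_eq_card, ← Nat.card_eq_fintype_card,
      (Subgroup.zpowers u).card_eq_card_quotient_mul_card_subgroup, Nat.card_zpowers,
      Fact.out (p := orderOf u = 2), Nat.mul_div_cancel _ two_pos]
  let h : L ≃ₗ[ℤ] (G ⧸ Subgroup.zpowers u → ℤ) := LinearEquiv.ofFinrankEq _ _ hcard
  -- Identifying L with ℤ^n turns ℤ^n → ℤ⟨G⟩ → L into an endomorphism, so that on the finitely
  -- generated module L / mL surjectivity forces injectivity.
  let θ : L →ₗ[ℤ] L :=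
    ((LinearMap.toSpanSingleton (ModGroupRing u) L e).toAddMonoidHom.toIntLinearMap ∘ₗ s) ∘ₗ
      h.toLinearMap
  let N : Submodule ℤ L := LinearMap.range (LinearMap.lsmul ℤ L (m : ℤ))
  have hθ : N ≤ N.comap θ := by
    rintro _ ⟨x, rfl⟩
    exact ⟨θ x, by simp⟩
  have hsurj : Function.Surjective (N.mapQ N θ hθ) := by
    intro q
    obtain ⟨x, rfl⟩ := N.mkQ_surjective q
    obtain ⟨a, y, hx⟩ := he x
    obtain ⟨z, hz⟩ := hs a
    refine ⟨N.mkQ (h.symm z), ?_⟩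
    rw [Submodule.mkQ_apply, Submodule.mapQ_apply, Submodule.mkQ_apply, Submodule.Quotient.eq]
    have hθz : θ (h.symm z) = a • e := by
      change s (h (h.symm z)) • e = _
      rw [LinearEquiv.apply_symm_apply, hz]
    rw [hθz, hx]
    exact ⟨-y, by simp⟩
  have hinj := OrzechProperty.injective_of_surjective_endomorphism _ hsurj
  obtain ⟨z, rfl⟩ := hs a
  have hθz : θ (h.symm z) = s z • e := by
    change s (h (h.symm z)) • e = _
    rw [LinearEquiv.apply_symm_apply]
  have : N.mkQ (h.symm z) = 0 := by
    apply hinj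
    rw [Submodule.mkQ_apply, Submodule.mapQ_apply, map_zero, Submodule.Quotient.mk_eq_zero, hθz, ha]
    exact ⟨y, by simp⟩
  rw [Submodule.mkQ_apply, Submodule.Quotient.mk_eq_zero] at this
  obtain ⟨x, hx⟩ := this
  refine ⟨s (h x), ?_⟩
  have : z = m • h x := by
    rw [← map_nsmul, ← LinearEquiv.symm_apply_eq, ← hx]
    simp
  rw [this, map_nsmul]

/-- The element w = e · ē is a unit modulo m when e generates L modulo m. If m divides aw, then ae
pairs with all of L into mℤ, so ae ∈ mL by unimodularity and m divides a. Multiplication by w is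
thus injective on the finite ring ℤ⟨G⟩ / m, hence surjective. -/
theorem exists_bezout (m : ℕ) (hm : 0 < m) :
    ∃ (e : L) (b c : ModGroupRing u), b * dot u L e (conj e) + m • c = 1 := by
  obtain ⟨e, he⟩ := exists_generator_mod u L m hm
  refine ⟨e, ?_⟩
  set w := dot u L e (conj e) with hw
  let N : Ideal (ModGroupRing u) := Ideal.span {(m : ModGroupRing u)}
  have hN {a : ModGroupRing u} : a ∈ N ↔ ∃ b, a = m • b := by
    rw [Ideal.mem_span_singleton]
    simp [dvd_def]
  have key (a : ModGroupRing u) (ha : a * w ∈ N) : a ∈ N := by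
    obtain ⟨c, hc⟩ := hN.1 ha
    have hform (y : L) : (m : ℤ) ∣ form (a • e) y := by
      obtain ⟨b, z, rfl⟩ := he y
      rw [map_add, map_nsmul, nsmul_eq_mul]
      refine dvd_add ?_ (dvd_mul_right _ _)
      rw [← trace_dot u, Conj.conj_smul, (dot u L _).map_smul, (dot u L).map_smul, LinearMap.smul_apply,
        ← hw, smul_eq_mul a, hc, smul_comm, map_nsmul, nsmul_eq_mul]
      exact dvd_mul_right _ _
    obtain ⟨y, hy⟩ := eq_nsmul_of_form (IsInvertible.unimodular (u := u)) hm _ hform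
    exact hN.2 (mem_of_smul_mem u L he a y hy)
  have hfin : Finite (ModGroupRing u ⧸ N) := by
    have : Module.Finite ℤ (ModGroupRing u ⧸ N) :=
      Module.Finite.of_surjective (Ideal.Quotient.mk N).toAddMonoidHom.toIntLinearMap
        Ideal.Quotient.mk_surjective
    refine Module.finite_of_fg_torsion _ fun {x} => ?_
    refine ⟨⟨(m : ℤ), by simp [hm.ne']⟩, ?_⟩
    obtain ⟨x, rfl⟩ := Ideal.Quotient.mk_surjective x
    change (m : ℤ) • Ideal.Quotient.mk N x = 0
    rw [← map_zsmul, Ideal.Quotient.eq_zero_iff_mem]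
    exact hN.2 ⟨x, by simp⟩
  have hinj : Function.Injective fun x : ModGroupRing u ⧸ N => x * Ideal.Quotient.mk N w := by
    intro x y hxy
    obtain ⟨x, rfl⟩ := Ideal.Quotient.mk_surjective x
    obtain ⟨y, rfl⟩ := Ideal.Quotient.mk_surjective y
    change Ideal.Quotient.mk N x * Ideal.Quotient.mk N w =
      Ideal.Quotient.mk N y * Ideal.Quotient.mk N w at hxy
    rw [← map_mul, ← map_mul, Ideal.Quotient.eq, ← sub_mul] at hxy
    exact Ideal.Quotient.eq.2 (key _ hxy)
  obtain ⟨b, hb⟩ := Finite.injective_iff_surjective.1 hinj 1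
  obtain ⟨b, rfl⟩ := Ideal.Quotient.mk_surjective b
  change Ideal.Quotient.mk N b * Ideal.Quotient.mk N w = _ at hb
  rw [← map_mul, ← map_one (Ideal.Quotient.mk N), eq_comm, Ideal.Quotient.eq] at hb
  obtain ⟨c, hc⟩ := hN.1 hb
  exact ⟨b, c, by rw [← hc]; ring⟩

/-- The lifted inner products generate the unit ideal. -/
theorem span_dot_eq_top :
    Ideal.span (Set.range fun p : L × Conj L => dot u L p.1 p.2) = ⊤ := by
  set I := Ideal.span (Set.range fun p : L × Conj L => dot u L p.1 p.2) with hI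
  have step (m : ℕ) (hm : 0 < m) : ∃ c : ModGroupRing u, 1 - m • c ∈ I := by
    obtain ⟨e, b, c, h⟩ := exists_bezout u L m hm
    refine ⟨c, ?_⟩
    rw [← h, add_sub_cancel_right]
    exact I.mul_mem_left _ (Ideal.subset_span ⟨(e, conj e), rfl⟩)
  have : Module.Finite ℤ (ModGroupRing u ⧸ I) :=
    Module.Finite.of_surjective (Ideal.Quotient.mk I).toAddMonoidHom.toIntLinearMap
      Ideal.Quotient.mk_surjective
  -- By `step` for m = 2 the quotient by I equals twice itself, so Nakayama's lemma gives an odd d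
  -- that kills it. Applying `step` again with m = |d| then puts 1 in I.
  obtain ⟨d, hd, hdI⟩ := Submodule.exists_sub_one_mem_and_smul_eq_zero_of_fg_of_le_smul
    (Ideal.span {(2 : ℤ)}) (⊤ : Submodule ℤ (ModGroupRing u ⧸ I)) Module.Finite.fg_top (by
      rintro q -
      obtain ⟨x, rfl⟩ := Ideal.Quotient.mk_surjective q
      obtain ⟨c, hc⟩ := step 2 two_pos
      have : Ideal.Quotient.mk I x = (2 : ℤ) • Ideal.Quotient.mk I (c * x) := by
        rw [← map_zsmul, Ideal.Quotient.eq]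
        have := I.mul_mem_right x hc
        simpa [sub_mul, mul_assoc] using this
      rw [this]
      exact Submodule.smul_mem_smul (Ideal.mem_span_singleton_self _) trivial)
  have hd2 : (2 : ℤ) ∣ d - 1 := Ideal.mem_span_singleton.1 hd
  have hd0 : 0 < d.natAbs := by
    rw [Int.natAbs_pos]
    rintro rfl
    norm_num at hd2
  have hdm : d • (1 : ModGroupRing u) ∈ I := by
    have := hdI (Ideal.Quotient.mk I 1) trivial
    rwa [← map_zsmul, Ideal.Quotient.eq_zero_iff_mem] at this
  obtain ⟨c, hc⟩ := step d.natAbs hd0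
  have h2 : d.natAbs • c ∈ I := by
    have h3 : d • c ∈ I := by simpa using I.mul_mem_right c hdm
    rw [← natCast_zsmul]
    rcases Int.natAbs_eq d with h | h
    · rwa [← h]
    · rw [h, neg_smul] at h3
      exact neg_mem_iff.1 h3
  rw [Ideal.eq_top_iff_one]
  simpa using I.add_mem hc h2

end Perfect

end GLattice

/-! ### The universal property of the extended tensor algebra. -/

noncomputable section

namespace ExtTensor

universe w v

variable {R : Type w} [CommRing R] {L M : Type v} [AddCommGroup L] [AddCommGroup M]
  [Module R L] [Module R M] (B : L →ₗ[R] M →ₗ[R] R)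
  {S : Type*} [CommRing S] [Algebra R S] (f : L →ₗ[R] S) (g : M →ₗ[R] S)

/-- The linear map from the extended tensor algebra to a commutative algebra that extends linear
maps on `L` and on `M` multiplicatively. -/
def liftAlg : Alg B →ₗ[R] S :=
  lift B (fun m => PiTensorProduct.lift
      ((MultilinearMap.mkPiAlgebra R (Fin m) S).compLinearMap fun _ => f))
    fun m => PiTensorProduct.lift
      ((MultilinearMap.mkPiAlgebra R (Fin (m + 1)) S).compLinearMap fun _ => g)

theorem liftAlg_inPos (m : ℕ) (z : Fin m → L) :
    liftAlg B f g (inPos B m (PiTensorProduct.tprod R z)) = ∏ i, f (z i) := by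
  rw [liftAlg, lift_inPos, PiTensorProduct.lift.tprod]
  simp

theorem liftAlg_inNeg (m : ℕ) (z : Fin (m + 1) → M) :
    liftAlg B f g (inNeg B m (PiTensorProduct.tprod R z)) = ∏ i, g (z i) := by
  rw [liftAlg, lift_inNeg, PiTensorProduct.lift.tprod]
  simp

theorem liftAlg_one : liftAlg B f g 1 = 1 := by
  rw [one_def, liftAlg_inPos, Fin.prod_univ_zero]

variable (hfg : ∀ x y, f x * g y = algebraMap R S (B x y))

include hfg

theorem liftAlg_mulPos (x : L) (p : Alg B) :
    liftAlg B f g (mulPos B x p) = f x * liftAlg B f g p := by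
  have h : liftAlg B f g ∘ₗ mulPos B x = LinearMap.mulLeft R (f x) ∘ₗ liftAlg B f g := by
    refine hom_ext B (fun m z => ?_) (fun m z => ?_)
    · simp only [LinearMap.comp_apply, mulPos_apply, LinearMap.mulLeft_apply]
      rw [mulPosFun_pos, liftAlg_inPos, liftAlg_inPos, Fin.prod_univ_succ]
      simp
    · simp only [LinearMap.comp_apply, mulPos_apply, LinearMap.mulLeft_apply]
      cases m with
      | zero =>
        rw [mulPosFun_neg_zero, map_smul]
        change _ • liftAlg B f g 1 = _
        rw [liftAlg_one, liftAlg_inNeg, Fin.prod_univ_one, hfg, Algebra.algebraMap_eq_smul_one]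
      | succ m =>
        rw [mulPosFun_neg_succ, map_smul, liftAlg_inNeg, liftAlg_inNeg, Fin.prod_univ_succ (n := m + 1),
          ← mul_assoc, hfg, Algebra.smul_def]
        rfl
  exact LinearMap.congr_fun h p

theorem liftAlg_mulNeg (y : M) (p : Alg B) :
    liftAlg B f g (mulNeg B y p) = g y * liftAlg B f g p := by
  have h : liftAlg B f g ∘ₗ mulNeg B y = LinearMap.mulLeft R (g y) ∘ₗ liftAlg B f g := by
    refine hom_ext B (fun m z => ?_) (fun m z => ?_)
    · simp only [LinearMap.comp_apply, mulNeg_apply, LinearMap.mulLeft_apply]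
      cases m with
      | zero =>
        rw [mulNegFun_zero, liftAlg_inNeg, liftAlg_inPos]
        simp
      | succ m =>
        rw [mulNegFun_pos_succ, map_smul, liftAlg_inPos, liftAlg_inPos, Fin.prod_univ_succ (n := m),
          ← mul_assoc, mul_comm (g y), hfg, Algebra.smul_def]
        rfl
    · simp only [LinearMap.comp_apply, mulNeg_apply, LinearMap.mulLeft_apply]
      rw [mulNegFun_neg, liftAlg_inNeg, liftAlg_inNeg, Fin.prod_univ_succ (n := m + 1)]
      simp
  exact LinearMap.congr_fun h p

/-- Left multiplications are built from those by single elements of L and M. For these, prefixing a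
factor is compatible with products by construction, and contraction is compatible by `hfg`. -/
theorem liftAlg_act (p q : Alg B) :
    liftAlg B f g (act B p q) = liftAlg B f g p * liftAlg B f g q := by
  have h : (act B).compr₂ (liftAlg B f g) =
      (LinearMap.mul R S).compl₁₂ (liftAlg B f g) (liftAlg B f g) := by
    refine hom_ext B (fun m z => ?_) (fun m z => ?_)
    · ext q
      simp only [LinearMap.compr₂_apply, LinearMap.compl₁₂_apply, LinearMap.mul_apply', act_pos,
        liftAlg_inPos]
      induction m with
      | zero => simp
      | succ m ih =>
        rw [List.ofFn_succ, List.prod_cons, Module.End.mul_apply, liftAlg_mulPos B f g hfg, ih,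
          Fin.prod_univ_succ, mul_assoc]
    · ext q
      simp only [LinearMap.compr₂_apply, LinearMap.compl₁₂_apply, LinearMap.mul_apply', act_neg,
        liftAlg_inNeg]
      have key (k : ℕ) (z : Fin k → M) : liftAlg B f g ((List.ofFn fun i => mulNeg B (z i)).prod q) =
          (∏ i, g (z i)) * liftAlg B f g q := by
        induction k with
        | zero => simp
        | succ k ih =>
          rw [List.ofFn_succ, List.prod_cons, Module.End.mul_apply, liftAlg_mulNeg B f g hfg, ih,
            Fin.prod_univ_succ, mul_assoc]
      exact key _ z
  exact LinearMap.congr_fun (LinearMap.congr_fun h p) q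

omit hfg

section Semilinear

variable {T : Type*} [CommRing T] (j : R →+* T) (f : L →+ T) (hf : ∀ a x, f (a • x) = j a * f x)
  (g : M →+ T) (hg : ∀ a y, g (a • y) = j a * g y)

/-- The semilinear variant of `liftAlg`. -/
def semiliftAlg : Alg B →+ T :=
  letI := j.toAlgebra
  (liftAlg B { f with map_smul' := hf } { g with map_smul' := hg }).toAddMonoidHom

theorem semiliftAlg_smul (a : R) (p : Alg B) :
    semiliftAlg B j f hf g hg (a • p) = j a * semiliftAlg B j f hf g hg p :=
  letI := j.toAlgebra
  map_smul (liftAlg B { f with map_smul' := hf } { g with map_smul' := hg }) a p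

theorem semiliftAlg_one : semiliftAlg B j f hf g hg 1 = 1 :=
  letI := j.toAlgebra
  liftAlg_one B { f with map_smul' := hf } { g with map_smul' := hg }

/-- The involution of Λ twists scalars by the bar map, so it is not linear. Viewing the target as an
algebra through `j` reduces it to the linear case. -/
theorem semiliftAlg_act (hfg : ∀ x y, f x * g y = j (B x y)) (p q : Alg B) :
    semiliftAlg B j f hf g hg (act B p q) =
      semiliftAlg B j f hf g hg p * semiliftAlg B j f hf g hg q :=
  letI := j.toAlgebra
  liftAlg_act B { f with map_smul' := hf } { g with map_smul' := hg } hfg p q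

theorem semiliftAlg_inPos (m : ℕ) (z : Fin m → L) :
    semiliftAlg B j f hf g hg (inPos B m (PiTensorProduct.tprod R z)) = ∏ i, f (z i) :=
  letI := j.toAlgebra
  liftAlg_inPos B { f with map_smul' := hf } { g with map_smul' := hg } m z

theorem semiliftAlg_inNeg (m : ℕ) (z : Fin (m + 1) → M) :
    semiliftAlg B j f hf g hg (inNeg B m (PiTensorProduct.tprod R z)) = ∏ i, g (z i) :=
  letI := j.toAlgebra
  liftAlg_inNeg B { f with map_smul' := hf } { g with map_smul' := hg } m z

end Semilinear

theorem mem_of_tprod_mem (N : Submodule R (Alg B))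
    (hpos : ∀ (m : ℕ) (z : Fin m → L), inPos B m (PiTensorProduct.tprod R z) ∈ N)
    (hneg : ∀ (m : ℕ) (z : Fin (m + 1) → M), inNeg B m (PiTensorProduct.tprod R z) ∈ N)
    (p : Alg B) : p ∈ N := by
  have h : N.mkQ = 0 := by
    refine hom_ext B (fun m z => ?_) (fun m z => ?_)
    · exact (Submodule.Quotient.mk_eq_zero N).2 (hpos m z)
    · exact (Submodule.Quotient.mk_eq_zero N).2 (hneg m z)
  exact (Submodule.Quotient.mk_eq_zero N).1 (LinearMap.congr_fun h p)

end ExtTensor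

/-! ### The grading and the involution of Λ. -/

namespace GLattice

open IntegralLattice
open Conj (conj)

variable {G : Type*} [CommGroup G] [Finite G] (u : G) (L : Type*)
  [AddCommGroup L] [IntegralLattice L] [DistribMulAction G L] [GLattice u L] [IsInvertible u L]

/-- The inclusion of `L` in the extended tensor algebra. -/
def ι : L →ₗ[ModGroupRing u] ExtAlg u L :=
  incl u L 1 ∘ₗ (PiTensorProduct.subsingletonEquiv (R := ModGroupRing u)
    (s := fun _ : Fin 1 => L) 0).symm.toLinearMap

/-- The inclusion of `L̄` in the extended tensor algebra. -/
def ιConj : Conj L →ₗ[ModGroupRing u] ExtAlg u L :=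
  inclConj u L 0 ∘ₗ (PiTensorProduct.subsingletonEquiv (R := ModGroupRing u)
    (s := fun _ : Fin 1 => Conj L) 0).symm.toLinearMap

theorem subsingletonEquiv_symm_apply' {R N : Type*} [CommRing R] [AddCommGroup N] [Module R N]
    (x : N) : (PiTensorProduct.subsingletonEquiv (R := R) (s := fun _ : Fin 1 => N) 0).symm x =
      PiTensorProduct.tprod R fun _ => x := by
  rw [LinearEquiv.symm_apply_eq]
  simp

theorem ι_apply (x : L) : ι u L x = incl u L 1 (PiTensorProduct.tprod _ fun _ => x) := by
  rw [ι, LinearMap.comp_apply, LinearEquiv.coe_coe, subsingletonEquiv_symm_apply']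

theorem ιConj_apply (y : Conj L) :
    ιConj u L y = inclConj u L 0 (PiTensorProduct.tprod _ fun _ => y) := by
  rw [ιConj, LinearMap.comp_apply, LinearEquiv.coe_coe, subsingletonEquiv_symm_apply']

theorem ι_mul_ιConj (x : L) (y : Conj L) :
    ι u L x * ιConj u L y = algebraMap _ _ (dot u L x y) := by
  rw [ι_apply, ιConj_apply, incl_mul_inclConj]

/-- Pure tensors are products in Λ, which turns tensor calculations into calculations in a
commutative ring. -/
theorem incl_tprod (m : ℕ) (z : Fin m → L) :
    incl u L m (PiTensorProduct.tprod _ z) = ∏ i, ι u L (z i) := by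
  induction m with
  | zero =>
    rw [Fin.prod_univ_zero, Subsingleton.elim z Fin.elim0]
    rfl
  | succ m ih =>
    rw [Fin.prod_univ_succ, ← ih, ι_apply, incl_mul_incl]
    congr 2
    exact (Fin.cons_self_tail z).symm

theorem inclConj_tprod (m : ℕ) (z : Fin (m + 1) → Conj L) :
    inclConj u L m (PiTensorProduct.tprod _ z) = ∏ i, ιConj u L (z i) := by
  induction m with
  | zero =>
    rw [Fin.prod_univ_one, ιConj_apply]
    congr 2
    ext i; fin_cases i; rfl
  | succ m ih =>
    rw [Fin.prod_univ_succ, ← ih, ιConj_apply, inclConj_mul_inclConj]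
    congr 2
    exact (Fin.cons_self_tail z).symm

/-- A submodule of the extended tensor algebra that contains all products of elements of `L` and
all products of elements of `L̄` is everything. -/
theorem mem_of_prod_mem (N : Submodule (ModGroupRing u) (ExtAlg u L))
    (hpos : ∀ (m : ℕ) (z : Fin m → L), ∏ i, ι u L (z i) ∈ N)
    (hneg : ∀ (m : ℕ) (z : Fin (m + 1) → Conj L), ∏ i, ιConj u L (z i) ∈ N) (p : ExtAlg u L) :
    p ∈ N :=
  ExtTensor.mem_of_tprod_mem (dot u L) N (fun m z => incl_tprod u L m z ▸ hpos m z)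
    (fun m z => inclConj_tprod u L m z ▸ hneg m z) p

/-- The homogeneous piece of degree `i` of the extended tensor algebra. -/
def gr (i : ℤ) : Submodule (ModGroupRing u) (ExtAlg u L) :=
  LinearMap.range (DirectSum.lof (ModGroupRing u) ℤ (ExtTensor.Pow (ModGroupRing u) L (Conj L)) i :
    _ →ₗ[ModGroupRing u] ExtAlg u L)

theorem gr_natCast (m : ℕ) : gr u L m = LinearMap.range (incl u L m) := rfl

theorem gr_negSucc (m : ℕ) : gr u L (Int.negSucc m) = LinearMap.range (inclConj u L m) := rfl

/-- The linear map on the extended tensor algebra with prescribed values on the pieces. -/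
def assemble {N : Type*} [AddCommGroup N] [Module (ModGroupRing u) N]
    (φ : ℤ → ExtAlg u L →ₗ[ModGroupRing u] N) : ExtAlg u L →ₗ[ModGroupRing u] N :=
  DirectSum.toModule (ModGroupRing u) ℤ N fun i => φ i ∘ₗ
    (DirectSum.lof (ModGroupRing u) ℤ (ExtTensor.Pow (ModGroupRing u) L (Conj L)) i :
      _ →ₗ[ModGroupRing u] ExtAlg u L)

theorem assemble_apply {N : Type*} [AddCommGroup N] [Module (ModGroupRing u) N]
    (φ : ℤ → ExtAlg u L →ₗ[ModGroupRing u] N) {i : ℤ} {p : ExtAlg u L} (hp : p ∈ gr u L i) :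
    assemble u L φ p = φ i p := by
  obtain ⟨p, rfl⟩ := hp
  exact DirectSum.toModule_lof (ModGroupRing u)
    (M := ExtTensor.Pow (ModGroupRing u) L (Conj L)) i p

/-- The component of degree zero. -/
def degZero : ExtAlg u L →ₗ[ModGroupRing u] ModGroupRing u :=
  ExtTensor.lift (dot u L)
    (fun | 0 => (PiTensorProduct.isEmptyEquiv (Fin 0)).toLinearMap
         | _ + 1 => 0) fun _ => 0

theorem degZero_algebraMap (a : ModGroupRing u) : degZero u L (algebraMap _ (ExtAlg u L) a) = a := by
  rw [Algebra.algebraMap_eq_smul_one, map_smul]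
  have : degZero u L 1 = 1 :=
    (ExtTensor.lift_inPos (dot u L) _ _ 0 _).trans (by simp)
  rw [this, smul_eq_mul, mul_one]

theorem gr_natCast_le (m : ℕ) (N : Submodule (ModGroupRing u) (ExtAlg u L))
    (h : ∀ z : Fin m → L, ∏ i, ι u L (z i) ∈ N) : gr u L m ≤ N := by
  rw [gr_natCast, LinearMap.range_eq_map, ← PiTensorProduct.span_tprod_eq_top, Submodule.map_span,
    Submodule.span_le]
  rintro _ ⟨_, ⟨z, rfl⟩, rfl⟩
  rw [incl_tprod]
  exact h z

theorem gr_negSucc_le (m : ℕ) (N : Submodule (ModGroupRing u) (ExtAlg u L))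
    (h : ∀ z : Fin (m + 1) → Conj L, ∏ i, ιConj u L (z i) ∈ N) : gr u L (Int.negSucc m) ≤ N := by
  rw [gr_negSucc, LinearMap.range_eq_map, ← PiTensorProduct.span_tprod_eq_top, Submodule.map_span,
    Submodule.span_le]
  rintro _ ⟨_, ⟨z, rfl⟩, rfl⟩
  rw [inclConj_tprod]
  exact h z

theorem prod_ι_mem (m : ℕ) (z : Fin m → L) : ∏ i, ι u L (z i) ∈ gr u L m :=
  ⟨_, incl_tprod u L m z⟩

theorem prod_ιConj_mem (m : ℕ) (z : Fin m → Conj L) : ∏ i, ιConj u L (z i) ∈ gr u L (-m) := by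
  cases m with
  | zero => exact ⟨_, by rw [Fin.prod_univ_zero]; rfl⟩
  | succ m => exact ⟨_, inclConj_tprod u L m z⟩

theorem gr_induction {i : ℤ} (N : Submodule (ModGroupRing u) (ExtAlg u L))
    (hpos : ∀ (m : ℕ), i = m → ∀ z : Fin m → L, ∏ k, ι u L (z k) ∈ N)
    (hneg : ∀ (m : ℕ), i = -(m + 1 : ℕ) → ∀ z : Fin (m + 1) → Conj L, ∏ k, ιConj u L (z k) ∈ N) :
    gr u L i ≤ N := by
  cases i with
  | ofNat m => exact gr_natCast_le u L m N (hpos m rfl)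
  | negSucc m => exact gr_negSucc_le u L m N (hneg m rfl)

section

/-- The involution of the extended tensor algebra that exchanges `x` and `x̄`, additively. -/
def starHom : ExtAlg u L →+ ExtAlg u L :=
  ExtTensor.semiliftAlg (dot u L)
    ((algebraMap (ModGroupRing u) (ExtAlg u L)).comp (ModGroupRing.bar u))
    ((ιConj u L).toAddMonoidHom.comp conj.toAddMonoidHom)
    (fun a x => by
      change ιConj u L (conj (a • x)) = _
      rw [Conj.conj_smul, map_smul, Algebra.smul_def]; rfl)
    ((ι u L).toAddMonoidHom.comp (conj (N := L)).symm.toAddMonoidHom)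
    (fun a x => by
      change ι u L (ModGroupRing.bar u a • conj.symm x) = _
      rw [map_smul, Algebra.smul_def]; rfl)

variable [Fact (orderOf u = 2)]

/-- The involution of the extended tensor algebra that exchanges `x` and `x̄`. -/
def star : ExtAlg u L →+* ExtAlg u L :=
  { starHom u L with
    map_one' := ExtTensor.semiliftAlg_one _ _ _ _ _ _
    map_mul' := ExtTensor.semiliftAlg_act _ _ _ _ _ _ fun x y => by
      have h : ιConj u L (conj x) * ι u L (conj.symm y) = algebraMap (ModGroupRing u) (ExtAlg u L)
          (ModGroupRing.bar u (dot u L x (conj (conj.symm y)))) := by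
        rw [mul_comm, ι_mul_ιConj, bar_dot]
      exact h }

theorem star_smul (a : ModGroupRing u) (p : ExtAlg u L) :
    star u L (a • p) = ModGroupRing.bar u a • star u L p := by
  rw [Algebra.smul_def (ModGroupRing.bar u a)]
  exact ExtTensor.semiliftAlg_smul (dot u L) _ _ _ _ _ a p

theorem star_algebraMap (a : ModGroupRing u) :
    star u L (algebraMap _ (ExtAlg u L) a) = algebraMap _ _ (ModGroupRing.bar u a) := by
  rw [Algebra.algebraMap_eq_smul_one, star_smul, map_one, ← Algebra.algebraMap_eq_smul_one]

theorem star_ι (x : L) : star u L (ι u L x) = ιConj u L (conj x) := by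
  rw [ι_apply]
  exact (ExtTensor.semiliftAlg_inPos (dot u L) _ _ _ _ _ 1 _).trans (Fin.prod_univ_one _)

theorem star_ιConj (x : L) : star u L (ιConj u L (conj x)) = ι u L x := by
  rw [ιConj_apply]
  exact (ExtTensor.semiliftAlg_inNeg (dot u L) _ _ _ _ _ 0 _).trans (Fin.prod_univ_one _)

end

attribute [local irreducible] instCommRingExtAlgOfIsInvertible

theorem ι_mul_mem (x : L) {i : ℤ} {p : ExtAlg u L} (hp : p ∈ gr u L i) :
    ι u L x * p ∈ gr u L (i + 1) := by
  refine gr_induction u L ((gr u L (i + 1)).comap (LinearMap.mulLeft _ (ι u L x))) ?_ ?_ hp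
  · rintro m rfl z
    have := prod_ι_mem u L (m + 1) (Fin.cons x z)
    rw [Fin.prod_univ_succ] at this
    simpa using this
  · rintro m rfl z
    have := prod_ιConj_mem u L m fun k => z k.succ
    rw [Submodule.mem_comap, LinearMap.mulLeft_apply, Fin.prod_univ_succ, ← mul_assoc, ι_mul_ιConj,
      ← Algebra.smul_def]
    refine Submodule.smul_mem _ _ ?_
    convert this using 2
    push_cast
    ring

theorem ιConj_mul_mem (y : Conj L) {i : ℤ} {p : ExtAlg u L} (hp : p ∈ gr u L i) :
    ιConj u L y * p ∈ gr u L (i - 1) := by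
  refine gr_induction u L ((gr u L (i - 1)).comap (LinearMap.mulLeft _ (ιConj u L y))) ?_ ?_ hp
  · rintro m rfl z
    rw [Submodule.mem_comap, LinearMap.mulLeft_apply]
    cases m with
    | zero =>
      have := prod_ιConj_mem u L 1 fun _ => y
      simpa using this
    | succ m =>
      have := prod_ι_mem u L m fun k => z k.succ
      rw [Fin.prod_univ_succ, ← mul_assoc, mul_comm (ιConj u L y), ι_mul_ιConj, ← Algebra.smul_def]
      refine Submodule.smul_mem _ _ ?_
      convert this using 2
      push_cast
      ring
  · rintro m rfl z
    have := prod_ιConj_mem u L (m + 2) (Fin.cons y z)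
    rw [Fin.prod_univ_succ] at this
    simp only [Fin.cons_zero, Fin.cons_succ] at this
    rw [Submodule.mem_comap, LinearMap.mulLeft_apply]
    convert this using 2
    push_cast
    ring

/-- A product of m vectors acts one vector at a time, each raising the degree by one for L and
lowering it by one for L̄, with a contraction to a scalar when the signs differ. -/
theorem mul_mem_gr {i j : ℤ} {p q : ExtAlg u L} (hp : p ∈ gr u L i) (hq : q ∈ gr u L j) :
    p * q ∈ gr u L (i + j) := by
  refine gr_induction u L ((gr u L (i + j)).comap (LinearMap.mulRight _ q)) ?_ ?_ hp
  · rintro m rfl z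
    rw [Submodule.mem_comap, LinearMap.mulRight_apply]
    clear hp
    induction m with
    | zero => simpa using hq
    | succ m ih =>
      rw [Fin.prod_univ_succ, mul_assoc]
      convert ι_mul_mem u L (z 0) (ih fun i => z i.succ) using 2
      push_cast
      ring
  · rintro m rfl z
    rw [Submodule.mem_comap, LinearMap.mulRight_apply]
    have key (k : ℕ) (z : Fin k → Conj L) : (∏ i, ιConj u L (z i)) * q ∈ gr u L (-k + j) := by
      induction k with
      | zero => simpa using hq
      | succ k ih =>
        rw [Fin.prod_univ_succ, mul_assoc]
        convert ιConj_mul_mem u L (z 0) (ih fun i => z i.succ) using 2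
        push_cast
        ring
    exact key _ z

theorem gr_mul_gr_le (i j : ℤ) : gr u L i * gr u L j ≤ gr u L (i + j) :=
  Submodule.mul_le.2 fun _ hp _ hq => mul_mem_gr u L hp hq

theorem one_mem_gr : (1 : ExtAlg u L) ∈ gr u L 0 := by
  simpa using prod_ι_mem u L 0 Fin.elim0

theorem algebraMap_mem_gr (a : ModGroupRing u) : algebraMap _ (ExtAlg u L) a ∈ gr u L 0 := by
  rw [Algebra.algebraMap_eq_smul_one]
  exact Submodule.smul_mem _ _ (one_mem_gr u L)

theorem pow_mem_gr {i : ℤ} {p : ExtAlg u L} (hp : p ∈ gr u L i) (k : ℕ) :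
    p ^ k ∈ gr u L (k * i) := by
  induction k with
  | zero => simpa using one_mem_gr u L
  | succ k ih =>
    rw [pow_succ]
    convert mul_mem_gr u L ih hp using 2
    push_cast
    ring

theorem exists_algebraMap {p : ExtAlg u L} (hp : p ∈ gr u L 0) :
    ∃ a, algebraMap (ModGroupRing u) (ExtAlg u L) a = p := by
  have h := gr_natCast_le u L 0 (LinearMap.range (Algebra.linearMap (ModGroupRing u) (ExtAlg u L)))
    (fun z => ⟨1, by simp⟩) hp
  obtain ⟨a, ha⟩ := h
  exact ⟨a, ha⟩

theorem iSup_gr : ⨆ i, gr u L i = ⊤ := by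
  rw [eq_top_iff]
  rintro p -
  refine mem_of_prod_mem u L _ (fun m z => ?_) (fun m z => ?_) p
  · exact Submodule.mem_iSup_of_mem _ (prod_ι_mem u L m z)
  · exact Submodule.mem_iSup_of_mem _ (prod_ιConj_mem u L (m + 1) z)

theorem algebraMap_injective : Function.Injective (algebraMap (ModGroupRing u) (ExtAlg u L)) :=
  Function.LeftInverse.injective (degZero_algebraMap u L)

section Star

variable [Fact (orderOf u = 2)]

theorem star_mem_gr {i : ℤ} {p : ExtAlg u L} (hp : p ∈ gr u L i) : star u L p ∈ gr u L (-i) := by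
  let N : Submodule (ModGroupRing u) (ExtAlg u L) :=
    { carrier := {p | star u L p ∈ gr u L (-i)}
      add_mem' := fun {p q} hp hq => by
        change star u L (p + q) ∈ gr u L (-i)
        rw [map_add]
        exact add_mem hp hq
      zero_mem' := by
        change star u L 0 ∈ gr u L (-i)
        rw [map_zero]
        exact zero_mem _
      smul_mem' := fun a p hp => by
        change star u L (a • p) ∈ gr u L (-i)
        rw [star_smul]
        exact Submodule.smul_mem _ _ hp }
  refine gr_induction u L N ?_ ?_ hp
  · rintro m rfl z
    change star u L _ ∈ gr u L _
    rw [map_prod]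
    simp only [star_ι]
    exact prod_ιConj_mem u L m fun k => conj (z k)
  · rintro m rfl z
    change star u L _ ∈ gr u L _
    rw [map_prod, neg_neg]
    have h (k : Fin (m + 1)) : star u L (ιConj u L (z k)) = ι u L (conj.symm (z k)) :=
      star_ιConj u L (conj.symm (z k))
    simp only [h]
    exact prod_ι_mem u L (m + 1) fun k => conj.symm (z k)

theorem tensorConj_add {G : Type*} [CommGroup G] (u : G) {L : Type*} [AddCommGroup L]
    [IntegralLattice L] [DistribMulAction G L] [GLattice u L] (m : ℕ) (a b : ⨂[ModGroupRing u]^m L) :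
    tensorConj u m (a + b) = tensorConj u m a + tensorConj u m b := by
  rw [tensorConj, map_add, map_add]
  rfl

theorem tensorConj_smul {G : Type*} [CommGroup G] (u : G) {L : Type*} [AddCommGroup L]
    [IntegralLattice L] [DistribMulAction G L] [GLattice u L] (m : ℕ) (c : ModGroupRing u) (a : ⨂[ModGroupRing u]^m L) :
    tensorConj u m (c • a) = ModGroupRing.bar u c • tensorConj u m a := by
  rw [tensorConj, map_smul]
  rfl

variable {L} in
-- Both sides are additive in a and b, and on pure tensors ∏ (x_i · ȳ_i) = (∏ x_i)(∏ ȳ_i). This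
-- translates shortness into a statement about Λ.
theorem algebraMap_tensorDot (m : ℕ) (a b : ⨂[ModGroupRing u]^m L) :
    algebraMap _ (ExtAlg u L) (tensorDot u m a (tensorConj u m b)) =
      incl u L m a * star u L (incl u L m b) := by
  induction a using PiTensorProduct.induction_on with
  | smul_tprod c x =>
    induction b using PiTensorProduct.induction_on with
    | smul_tprod d y =>
      rw [tensorConj_smul, tensorConj_tprod, (tensorDot u m _).map_smul, (tensorDot u m).map_smul,
        LinearMap.smul_apply, tensorDot_tprod, (incl u L m).map_smul, (incl u L m).map_smul,
        star_smul, incl_tprod, incl_tprod, map_prod,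
        smul_mul_smul_comm, ← Finset.prod_mul_distrib, Algebra.smul_def (A := ExtAlg u L),
        smul_eq_mul, smul_eq_mul, map_mul, map_mul, map_mul, map_prod]
      simp only [star_ι, ι_mul_ιConj]
      ring
    | add b b' hb hb' => rw [tensorConj_add, map_add, map_add, map_add, map_add, hb, hb', mul_add]
  | add a a' ha ha' =>
    rw [map_add, LinearMap.add_apply, map_add, map_add, ha, ha', add_mul]

/-- For m = 1 this is `span_dot_eq_top`, and the general case follows by taking products. It
expresses that L̄ is inverse to L. -/
theorem one_mem_gr_mul_gr (m : ℕ) : (1 : ExtAlg u L) ∈ gr u L m * gr u L (-m) := by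
  have h1 : (1 : ExtAlg u L) ∈ gr u L 1 * gr u L (-1) := by
    have h : (⊤ : Ideal (ModGroupRing u)) ≤
        (gr u L 1 * gr u L (-1)).comap (Algebra.linearMap (ModGroupRing u) (ExtAlg u L)) := by
      rw [← span_dot_eq_top u L, Ideal.span, Submodule.span_le]
      rintro _ ⟨⟨x, y⟩, rfl⟩
      change algebraMap (ModGroupRing u) (ExtAlg u L) (dot u L x y) ∈ gr u L 1 * gr u L (-1)
      rw [← ι_mul_ιConj]
      refine Submodule.mul_mem_mul ?_ ?_
      · simpa using prod_ι_mem u L 1 fun _ => x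
      · simpa using prod_ιConj_mem u L 1 fun _ => y
    simpa using h (Submodule.mem_top : (1 : ModGroupRing u) ∈ ⊤)
  induction m with
  | zero => simpa using Submodule.mul_mem_mul (one_mem_gr u L) (one_mem_gr u L)
  | succ m ih =>
    have := Submodule.mul_mem_mul ih h1
    rw [one_mul, mul_mul_mul_comm] at this
    have h2 : gr u L (-m) * gr u L (-1) ≤ gr u L (-(m + 1 : ℕ)) := by
      convert gr_mul_gr_le u L (-m) (-1) using 2
      push_cast
      ring
    exact mul_le_mul' (by exact_mod_cast gr_mul_gr_le u L m 1) h2 this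

theorem eq_zero_of_mul_gr (m : ℕ) {p : ExtAlg u L} (h : ∀ q ∈ gr u L (-m), p * q = 0) : p = 0 := by
  rw [← mul_one p]
  refine Submodule.mul_induction_on (C := fun q => p * q = 0) (one_mem_gr_mul_gr u L m)
    (fun x _ y hy => ?_) (fun x y hx hy => by rw [mul_add, hx, hy, add_zero])
  rw [mul_left_comm, h y hy, mul_zero]

/-- Multiplying by elements of degree -m moves p to degree zero, where ℤ⟨G⟩ is torsion-free. -/
theorem eq_zero_of_zsmul (m : ℕ) {p : ExtAlg u L} (hp : p ∈ gr u L m) {k : ℤ} (hk : k ≠ 0)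
    (h : k • p = 0) : p = 0 := by
  refine eq_zero_of_mul_gr u L m fun q hq => ?_
  have hpq : p * q ∈ gr u L 0 := by simpa using mul_mem_gr u L hp hq
  obtain ⟨a, ha⟩ := exists_algebraMap u L hpq
  have : a = 0 := ModGroupRing.eq_zero_of_zsmul_eq_zero hk (algebraMap_injective u L (by
    rw [map_zsmul, ha, ← smul_mul_assoc, h, zero_mul, map_zero]))
  rw [← ha, this, map_zero]

end Star

end GLattice

end

/-! ### Positive definiteness on tensor powers, and vectors of norm one. -/

noncomputable section

namespace GLattice

open IntegralLattice
open Conj (conj)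

theorem form_self_nonneg (L : Type*) [AddCommGroup L] [IntegralLattice L] (x : L) :
    0 ≤ form x x := by
  rcases eq_or_ne x 0 with rfl | hx
  · simp
  · exact (pos x hx).le

theorem eq_zero_of_form_self (L : Type*) [AddCommGroup L] [IntegralLattice L] {x : L}
    (h : form x x = 0) : x = 0 := by
  by_contra hx
  exact (pos x hx).ne' h

theorem trace_mul_bar_mul_dot {G : Type*} [CommGroup G] [Finite G] (u : G) [Fact (orderOf u = 2)]
    {L : Type*} [AddCommGroup L] [IntegralLattice L] [DistribMulAction G L] [GLattice u L] (c : ModGroupRing u) (f : L) :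
    ModGroupRing.trace u (c * ModGroupRing.bar u c * dot u L f (conj f)) = form (c • f) (c • f) := by
  rw [← trace_dot u, Conj.conj_smul, (dot u L _).map_smul, (dot u L).map_smul,
    LinearMap.smul_apply, smul_eq_mul, smul_eq_mul]
  ring_nf

variable {G : Type*} [CommGroup G] [Finite G] (u : G) (L : Type*)
  [AddCommGroup L] [IntegralLattice L] [DistribMulAction G L] [GLattice u L] [IsInvertible u L]

attribute [local irreducible] instCommRingExtAlgOfIsInvertible

/-- In a product of m vectors each factor absorbs one d and becomes a multiple of f. -/
theorem exists_pow_smul_eq {d : ℤ} {f : L} (hf : ∀ x : L, ∃ a : ModGroupRing u, d • x = a • f)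
    (m : ℕ) {p : ExtAlg u L} (hp : p ∈ gr u L m) :
    ∃ c : ModGroupRing u, d ^ m • p = c • ι u L f ^ m := by
  let N : Submodule (ModGroupRing u) (ExtAlg u L) :=
    (Submodule.span (ModGroupRing u) {ι u L f ^ m}).comap
      ((d ^ m) • (LinearMap.id : ExtAlg u L →ₗ[ModGroupRing u] ExtAlg u L))
  have h : p ∈ N := by
    refine gr_natCast_le u L m N (fun z => ?_) hp
    choose c hc using hf
    refine Submodule.mem_span_singleton.2 ⟨∏ i, c (z i), ?_⟩
    have h (i : Fin m) : (d : ExtAlg u L) * ι u L (z i) =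
        algebraMap (ModGroupRing u) (ExtAlg u L) (c (z i)) * ι u L f := by
      rw [← zsmul_eq_mul, ← map_zsmul, hc, map_smul, Algebra.smul_def]
    have h2 := Finset.prod_congr (rfl : (Finset.univ : Finset (Fin m)) = _) fun i _ => h i
    rw [Finset.prod_mul_distrib, Finset.prod_mul_distrib, Finset.prod_const, Finset.prod_const,
      Finset.card_univ, Fintype.card_fin,
      ← map_prod (algebraMap (ModGroupRing u) (ExtAlg u L)), ← Algebra.smul_def, ← Int.cast_pow,
      ← zsmul_eq_mul] at h2
    exact h2.symm
  obtain ⟨c, hc⟩ := Submodule.mem_span_singleton.1 h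
  exact ⟨c, hc.symm⟩

variable [Fact (orderOf u = 2)]

theorem star_star (p : ExtAlg u L) : star u L (star u L p) = p := by
  let N : Submodule (ModGroupRing u) (ExtAlg u L) :=
    { carrier := {p | star u L (star u L p) = p}
      add_mem' := fun {p q} hp hq => by
        change star u L (star u L (p + q)) = p + q
        rw [map_add, map_add]
        exact congrArg₂ _ hp hq
      zero_mem' := by
        change star u L (star u L 0) = 0
        rw [map_zero, map_zero]
      smul_mem' := fun a p hp => by
        change star u L (star u L (a • p)) = a • p
        rw [star_smul, star_smul, ModGroupRing.bar_bar]
        exact congrArg _ hp }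
  refine mem_of_prod_mem u L N (fun m z => ?_) (fun m z => ?_) p
  · change star u L (star u L _) = _
    simp only [map_prod, star_ι, star_ιConj]
  · change star u L (star u L _) = _
    rw [map_prod, map_prod]
    refine Finset.prod_congr rfl fun k _ => ?_
    obtain ⟨y, hy⟩ := conj.surjective (z k)
    rw [← hy, star_ιConj, star_ι]

/-- The scaled trace of the component of degree zero. -/
def tr : ExtAlg u L →+ ℤ := (ModGroupRing.trace u).comp (degZero u L).toAddMonoidHom

theorem tr_algebraMap (a : ModGroupRing u) :
    tr u L (algebraMap _ (ExtAlg u L) a) = ModGroupRing.trace u a :=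
  congrArg _ (degZero_algebraMap u L a)

/-- The scalar dc kills L, hence all lifted inner products, hence the unit ideal which they
generate. -/
theorem eq_zero_of_smul_generator {d : ℤ} (hd : d ≠ 0) {f : L}
    (hf : ∀ x : L, ∃ a : ModGroupRing u, d • x = a • f) {c : ModGroupRing u} (hc : c • f = 0) :
    c = 0 := by
  have h (x : L) : (d • c) • x = 0 := by
    obtain ⟨a, ha⟩ := hf x
    rw [smul_assoc, smul_comm, ha, smul_comm, hc, smul_zero]
  have hle : (⊤ : Ideal (ModGroupRing u)) ≤
      LinearMap.ker (LinearMap.mulLeft (ModGroupRing u) (d • c)) := by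
    rw [← span_dot_eq_top u L, Ideal.span, Submodule.span_le]
    rintro _ ⟨⟨x, y⟩, rfl⟩
    change (d • c) * dot u L x y = 0
    rw [← smul_eq_mul, ← LinearMap.smul_apply, ← map_smul, h, map_zero, LinearMap.zero_apply]
  have := hle (Submodule.mem_top : (1 : ModGroupRing u) ∈ ⊤)
  rw [LinearMap.mem_ker, LinearMap.mulLeft_apply, mul_one] at this
  exact ModGroupRing.eq_zero_of_zsmul_eq_zero hd this

/-- Put w = f · f̄, which is fixed by the bar map and is not a zero divisor. For m = 2k the quantity
is the norm of c w^k in ℤ⟨G⟩; for m = 2k + 1 it is the norm of (c w^k) f in L. -/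
theorem trace_mul_bar_mul_dot_pow {d : ℤ} (hd : d ≠ 0) {f : L}
    (hf : ∀ x : L, ∃ a : ModGroupRing u, d • x = a • f) (c : ModGroupRing u) (m : ℕ) :
    0 ≤ ModGroupRing.trace u (c * ModGroupRing.bar u c * dot u L f (conj f) ^ m) ∧
      (ModGroupRing.trace u (c * ModGroupRing.bar u c * dot u L f (conj f) ^ m) = 0 → c = 0) := by
  have hbar := bar_dot u f f
  have hnz (c : ModGroupRing u) (h : c * dot u L f (conj f) = 0) : c = 0 := by
    refine eq_zero_of_smul_generator u L hd hf (eq_zero_of_form_self L ?_)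
    rw [← trace_mul_bar_mul_dot, mul_right_comm, h, zero_mul, map_zero]
  have hnzp (k : ℕ) (c : ModGroupRing u) (h : c * dot u L f (conj f) ^ k = 0) : c = 0 := by
    induction k with
    | zero => simpa using h
    | succ k ih =>
      rw [pow_succ, ← mul_assoc] at h
      exact ih (hnz _ h)
  rcases Nat.even_or_odd' m with ⟨k, rfl | rfl⟩
  · have h : c * ModGroupRing.bar u c * dot u L f (conj f) ^ (2 * k) =
        (c * dot u L f (conj f) ^ k) * ModGroupRing.bar u (c * dot u L f (conj f) ^ k) := by
      rw [map_mul, map_pow, hbar]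
      ring
    rw [h]
    exact ⟨ModGroupRing.trace_mul_bar_nonneg _,
      fun h0 => hnzp k c (ModGroupRing.eq_zero_of_trace_mul_bar h0)⟩
  · have h : c * ModGroupRing.bar u c * dot u L f (conj f) ^ (2 * k + 1) =
        (c * dot u L f (conj f) ^ k) * ModGroupRing.bar u (c * dot u L f (conj f) ^ k) *
          dot u L f (conj f) := by
      rw [map_mul, map_pow, hbar]
      ring
    rw [h, trace_mul_bar_mul_dot]
    exact ⟨form_self_nonneg L _, fun h0 => hnzp k c
      (eq_zero_of_smul_generator u L hd hf (eq_zero_of_form_self L h0))⟩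

/-- The inner product on the tensor powers of an invertible lattice is positive definite. -/
theorem tr_mul_star_posDef (m : ℕ) {p : ExtAlg u L} (hp : p ∈ gr u L m) :
    0 ≤ tr u L (p * star u L p) ∧ (tr u L (p * star u L p) = 0 → p = 0) := by
  obtain ⟨d, hd, f, hf⟩ := exists_coprime_smul u L 2 two_pos
  have hd0 : d ≠ 0 := by
    rintro rfl
    norm_num at hd
  have hdm : d ^ m ≠ 0 := pow_ne_zero m hd0
  obtain ⟨c, hc⟩ := exists_pow_smul_eq u L hf m hp
  obtain ⟨h0, h1⟩ := trace_mul_bar_mul_dot_pow u L hd0 hf c m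
  -- Since d^m p = c f^m, the product p p̄ multiplied by d^{2m} is c c̄ w^m.
  have key : (d ^ m) * (d ^ m) * tr u L (p * star u L p) =
      ModGroupRing.trace u (c * ModGroupRing.bar u c * dot u L f (conj f) ^ m) := by
    have h2 : (d ^ m * d ^ m) • (p * star u L p) = algebraMap (ModGroupRing u) (ExtAlg u L)
        (c * ModGroupRing.bar u c * dot u L f (conj f) ^ m) := by
      have h3 : (d ^ m * d ^ m) • (p * star u L p) = (d ^ m • p) * star u L (d ^ m • p) := by
        rw [map_zsmul, smul_mul_smul_comm]
      rw [h3, hc, star_smul, map_pow, star_ι, smul_mul_smul_comm, ← mul_pow, ι_mul_ιConj,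
        Algebra.smul_def, map_mul, map_mul, map_mul, map_pow]
    rw [← tr_algebraMap u L, ← h2, map_zsmul, smul_eq_mul]
  have hpos : 0 < d ^ m * d ^ m := mul_self_pos.2 hdm
  refine ⟨?_, fun h => ?_⟩
  · rw [← key] at h0
    exact nonneg_of_mul_nonneg_right h0 hpos
  · rw [h, mul_zero] at key
    have hc0 := h1 key.symm
    rw [hc0, zero_smul] at hc
    exact eq_zero_of_zsmul u L m hp hdm hc

theorem mul_star_mem {i : ℤ} {p q : ExtAlg u L} (hp : p ∈ gr u L i) (hq : q ∈ gr u L i) :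
    p * star u L q ∈ gr u L 0 := by
  simpa using mul_mem_gr u L hp (star_mem_gr u L hq)

/-- The group elements that fix a vector up to sign. -/
def signStabilizer (v : ExtAlg u L) : Subgroup G where
  carrier := {σ | ModGroupRing.of u σ • v = v ∨ ModGroupRing.of u σ • v = -v}
  one_mem' := by simp
  mul_mem' := by
    rintro σ τ (h | h) (h' | h') <;> simp [mul_smul, h, h']
  inv_mem' := by
    rintro σ (h | h)
    · left
      conv_lhs => rw [← h]
      rw [← mul_smul, ← map_mul, inv_mul_cancel, map_one, one_smul]
    · right
      rw [eq_neg_iff_add_eq_zero, add_comm, ← eq_neg_iff_add_eq_zero, ← smul_neg, ← h, ← mul_smul,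
        ← map_mul, inv_mul_cancel, map_one, one_smul]

/-- Write 1 as a sum of products xy of elements of degrees m and -m. With a = vy and b = x v̄ in
degree zero, 2 t(ab) = ∑ t(a σ⁻¹) t(b σ). Replacing σ by σk with kv = ±v multiplies both factors by
the same sign, so the summand is invariant under the stabilizer, whose order divides the sum. -/
theorem card_signStabilizer_dvd (m : ℕ) {v : ExtAlg u L} (hv : v ∈ gr u L m) :
    (Nat.card (signStabilizer u L v) : ℤ) ∣ 2 * tr u L (v * star u L v) := by
  have := Fintype.ofFinite G
  have key : ∀ q ∈ gr u L m * gr u L (-m),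
      (Nat.card (signStabilizer u L v) : ℤ) ∣ 2 * tr u L (v * q * star u L v) := by
    intro q hq
    refine Submodule.mul_induction_on (C := fun q =>
      (Nat.card (signStabilizer u L v) : ℤ) ∣ 2 * tr u L (v * q * star u L v)) hq
      (fun x hx y hy => ?_) (fun x y hx hy => by
        rw [mul_add, add_mul, map_add, mul_add]; exact dvd_add hx hy)
    obtain ⟨a, ha⟩ := exists_algebraMap u L (p := v * y) (by simpa using mul_mem_gr u L hv hy)
    obtain ⟨b, hb⟩ := exists_algebraMap u L (mul_star_mem u L hx hv)
    have h : v * (x * y) * star u L v = algebraMap (ModGroupRing u) (ExtAlg u L) (a * b) := by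
      rw [map_mul, ha, hb]
      ring
    rw [h, tr_algebraMap, ModGroupRing.two_mul_trace_mul]
    refine Subgroup.card_dvd_sum_of_forall_mul_eq _ _ fun k hk σ => ?_
    have ha' (ρ : G) : algebraMap (ModGroupRing u) (ExtAlg u L) (a * ModGroupRing.of u ρ) =
        (ModGroupRing.of u ρ • v) * y := by
      rw [map_mul, ha, Algebra.smul_def]; ring
    have hb' (ρ : G) : algebraMap (ModGroupRing u) (ExtAlg u L) (b * ModGroupRing.of u ρ) =
        x * star u L (ModGroupRing.of u ρ⁻¹ • v) := by
      rw [map_mul, hb, star_smul, ModGroupRing.bar_of, inv_inv, Algebra.smul_def]; ring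
    rw [mul_inv, (ModGroupRing.of u).map_mul, mul_comm (ModGroupRing.of u σ⁻¹), ← mul_assoc,
      (ModGroupRing.of u).map_mul, mul_comm (ModGroupRing.of u σ), ← mul_assoc]
    have hinj := algebraMap_injective u L
    rcases (signStabilizer u L v).inv_mem hk with hk | hk
    · have h1 : a * ModGroupRing.of u k⁻¹ = a := hinj (by rw [ha', hk, ha])
      have h2 : b * ModGroupRing.of u k = b := hinj (by rw [hb', hk, hb])
      rw [h1, h2]
    · have h1 : a * ModGroupRing.of u k⁻¹ = -a := hinj (by rw [ha', hk, map_neg, ha, neg_mul])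
      have h2 : b * ModGroupRing.of u k = -b := hinj (by
        rw [hb', hk, map_neg, map_neg, hb, mul_neg])
      rw [h1, h2, neg_mul, neg_mul, map_neg, map_neg, neg_mul_neg]
  simpa using key 1 (one_mem_gr_mul_gr u L m)

/-- When v has norm 1 the order of the stabilizer divides 2, and ⟨u⟩ already fills it. -/
theorem eq_one_or_eq_of_mem_signStabilizer (m : ℕ) {v : ExtAlg u L} (hv : v ∈ gr u L m)
    (h : tr u L (v * star u L v) = 1) {σ : G} (hσ : σ ∈ signStabilizer u L v) : σ = 1 ∨ σ = u := by
  have hd := card_signStabilizer_dvd u L m hv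
  rw [h, mul_one] at hd
  have hle : Subgroup.zpowers u ≤ signStabilizer u L v := by
    rw [Subgroup.zpowers_le]
    right
    rw [ModGroupRing.of_self, neg_smul, one_smul]
  have hcard : Nat.card (signStabilizer u L v) ≤ Nat.card (Subgroup.zpowers u) := by
    rw [Nat.card_zpowers, Fact.out (p := orderOf u = 2)]
    exact Nat.le_of_dvd two_pos (by exact_mod_cast hd)
  rw [← Subgroup.eq_of_le_of_card_ge hle hcard, Subgroup.mem_zpowers_iff] at hσ
  obtain ⟨k, rfl⟩ := hσ
  rcases Int.even_or_odd' k with ⟨l, rfl | rfl⟩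
  · left
    rw [zpow_mul, zpow_two, ModGroupRing.self_mul_self, one_zpow]
  · right
    rw [zpow_add, zpow_mul, zpow_two, ModGroupRing.self_mul_self, one_zpow, one_mul, zpow_one]

/-- A short vector of a tensor power has lifted norm `1`. -/
theorem mul_star_eq_one (m : ℕ) {v : ExtAlg u L} (hv : v ∈ gr u L m)
    (h : tr u L (v * star u L v) = 1) : v * star u L v = 1 := by
  obtain ⟨w, hw⟩ := exists_algebraMap u L (mul_star_mem u L hv hv)
  have htw : ModGroupRing.trace u w = 1 := by rw [← tr_algebraMap u L, hw, h]
  have hbar : ModGroupRing.bar u w = w := algebraMap_injective u L (by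
    rw [← star_algebraMap, hw, map_mul, star_star, mul_comm])
  have hw1 : w = 1 := by
    refine ModGroupRing.ext_trace fun σ => ?_
    rw [one_mul]
    have hsymm : ModGroupRing.trace u (w * ModGroupRing.of u σ⁻¹) =
        ModGroupRing.trace u (w * ModGroupRing.of u σ) := by
      rw [← ModGroupRing.trace_bar, map_mul, hbar, ModGroupRing.bar_of, inv_inv]
    have hσ := ModGroupRing.of_mul_of_inv (u := u) σ
    have hmem := Submodule.smul_mem (gr u L m) (ModGroupRing.of u σ) hv
    -- The norms of v - σv and v + σv are 2 ∓ 2 t(wσ). If σv ≠ ±v, both are positive, which forces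
    -- the integer t(wσ) to be 0, as for w = 1.
    have hsub := tr_mul_star_posDef u L m (sub_mem hv hmem)
    have hadd := tr_mul_star_posDef u L m (add_mem hv hmem)
    have e1 : tr u L ((v - ModGroupRing.of u σ • v) * star u L (v - ModGroupRing.of u σ • v)) =
        2 - 2 * ModGroupRing.trace u (w * ModGroupRing.of u σ) := by
      have : (v - ModGroupRing.of u σ • v) * star u L (v - ModGroupRing.of u σ • v) =
          algebraMap (ModGroupRing u) (ExtAlg u L) (w * (1 + ModGroupRing.of u σ *
            ModGroupRing.of u σ⁻¹) - w * ModGroupRing.of u σ - w * ModGroupRing.of u σ⁻¹) := by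
        simp only [map_sub, map_mul, map_add, map_one, hw, star_algebraMap, ModGroupRing.bar_of,
          Algebra.smul_def]
        ring
      rw [this, tr_algebraMap, hσ, map_sub, map_sub, hsymm, mul_add, mul_one, map_add, htw]
      ring
    have e2 : tr u L ((v + ModGroupRing.of u σ • v) * star u L (v + ModGroupRing.of u σ • v)) =
        2 + 2 * ModGroupRing.trace u (w * ModGroupRing.of u σ) := by
      have : (v + ModGroupRing.of u σ • v) * star u L (v + ModGroupRing.of u σ • v) =
          algebraMap (ModGroupRing u) (ExtAlg u L) (w * (1 + ModGroupRing.of u σ *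
            ModGroupRing.of u σ⁻¹) + w * ModGroupRing.of u σ + w * ModGroupRing.of u σ⁻¹) := by
        simp only [map_add, map_mul, map_one, hw, star_algebraMap, ModGroupRing.bar_of,
          Algebra.smul_def]
        ring
      rw [this, tr_algebraMap, hσ, map_add, map_add, hsymm, mul_add, mul_one, map_add, htw]
      ring
    rw [e1] at hsub
    rw [e2] at hadd
    by_cases hK : σ ∈ signStabilizer u L v
    · rcases eq_one_or_eq_of_mem_signStabilizer u L m hv h hK with rfl | rfl
      · rw [map_one, mul_one, htw, ModGroupRing.trace_one]
      · rw [ModGroupRing.trace_mul_of_self, htw, ModGroupRing.of_self, map_neg,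
          ModGroupRing.trace_one]
    · rw [ModGroupRing.trace_of_eq_zero]
      · have h1 : 2 - 2 * ModGroupRing.trace u (w * ModGroupRing.of u σ) ≠ 0 := fun h0 =>
          hK (Or.inl (sub_eq_zero.1 (hsub.2 h0)).symm)
        have h2 : 2 + 2 * ModGroupRing.trace u (w * ModGroupRing.of u σ) ≠ 0 := fun h0 =>
          hK (Or.inr (eq_neg_of_add_eq_zero_right (hadd.2 h0)))
        omega
      · rintro rfl; exact hK (one_mem _)
      · rintro rfl
        exact hK (Or.inr (by rw [ModGroupRing.of_self, neg_smul, one_smul]))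
  rw [← hw, hw1, map_one]

variable {L} in
theorem incl_mul_star_of_isShort {r : ℕ} {ν : ⨂[ModGroupRing u]^r L} (hν : IsShort u ν) :
    incl u L r ν * star u L (incl u L r ν) = 1 := by
  refine mul_star_eq_one u L r ⟨ν, rfl⟩ ?_
  rw [← algebraMap_tensorDot, tr_algebraMap]
  exact hν

end GLattice

end

/-! ### The quotient by ν - 1: folding degrees modulo r, and roots of unity. -/

noncomputable section

namespace GLattice

open IntegralLattice
open Conj (conj)

variable {G : Type*} [CommGroup G] [Finite G] {u : G} {L : Type*}
  [AddCommGroup L] [IntegralLattice L] [DistribMulAction G L] [GLattice u L] [IsInvertible u L]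

attribute [local irreducible] instCommRingExtAlgOfIsInvertible

section Quotient

variable {r : ℕ} {ν : ⨂[ModGroupRing u]^r L}

variable (u ν) in
/-- The quotient map to the ring of roots. -/
def toQuot : ExtAlg u L →+* RootRing u ν :=
  Ideal.Quotient.mk (Ideal.span {incl u L r ν - 1})

theorem toQuot_surjective : Function.Surjective (toQuot u ν) := Ideal.Quotient.mk_surjective

theorem toQuot_eq_iff {p q : ExtAlg u L} :
    toQuot u ν p = toQuot u ν q ↔ ∃ c, c * (incl u L r ν - 1) = p - q := by
  rw [toQuot, Ideal.Quotient.eq, Ideal.mem_span_singleton']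

theorem toQuot_incl : toQuot u ν (incl u L r ν) = 1 := by
  rw [← map_one (toQuot u ν), toQuot_eq_iff]
  exact ⟨1, one_mul _⟩

theorem incl_mem_gr (ν : ⨂[ModGroupRing u]^r L) : incl u L r ν ∈ gr u L r := ⟨ν, rfl⟩

variable [Fact (orderOf u = 2)] (hν : incl u L r ν * star u L (incl u L r ν) = 1)

/-- A vector of lifted norm `1`, as a unit of the extended tensor algebra. -/
def normOneUnit : (ExtAlg u L)ˣ :=
  Units.mkOfMulEqOne (incl u L r ν) (star u L (incl u L r ν)) hν

theorem normOneUnit_zpow_mem (k : ℤ) :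
    ((normOneUnit hν ^ k : (ExtAlg u L)ˣ) : ExtAlg u L) ∈ gr u L (k * r) := by
  cases k with
  | ofNat k =>
    rw [Int.ofNat_eq_natCast, zpow_natCast, Units.val_pow_eq_pow_val]
    exact pow_mem_gr u L (incl_mem_gr ν) k
  | negSucc k =>
    rw [zpow_negSucc, ← inv_pow, Units.val_pow_eq_pow_val]
    convert pow_mem_gr u L (star_mem_gr u L (incl_mem_gr ν)) (k + 1) using 2
    · rw [Int.negSucc_eq]
      push_cast
      ring
    · rfl

theorem toQuot_zpow_mul (k : ℤ) (p : ExtAlg u L) :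
    toQuot u ν ((normOneUnit hν ^ k : (ExtAlg u L)ˣ) * p) = toQuot u ν p := by
  have h : Units.map (toQuot u ν : ExtAlg u L →* RootRing u ν) (normOneUnit hν) = 1 :=
    Units.ext toQuot_incl
  have h2 : toQuot u ν ((normOneUnit hν ^ k : (ExtAlg u L)ˣ) : ExtAlg u L) = 1 := by
    change ((Units.map (toQuot u ν : ExtAlg u L →* RootRing u ν) (normOneUnit hν ^ k) :
      (RootRing u ν)ˣ) : RootRing u ν) = 1
    rw [map_zpow, h, one_zpow, Units.val_one]
  rw [map_mul, h2, one_mul]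

include hν in
-- The involution descends to A because ν̄ - 1 = -ν̄ (ν - 1) lies in the ideal.
theorem toQuot_star {p q : ExtAlg u L} (h : toQuot u ν p = toQuot u ν q) :
    toQuot u ν (star u L p) = toQuot u ν (star u L q) := by
  obtain ⟨c, hc⟩ := toQuot_eq_iff.1 h
  refine toQuot_eq_iff.2 ⟨-(star u L c * star u L (incl u L r ν)), ?_⟩
  rw [← map_sub, ← hc, map_mul, map_sub, map_one]
  linear_combination -star u L c * hν

/-- The sum of the components of degree divisible by `r`, shifted to degree zero by powers of `ν`. -/
def periodicDegZero : ExtAlg u L →ₗ[ModGroupRing u] ModGroupRing u :=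
  assemble u L fun i => if (r : ℤ) ∣ i then degZero u L ∘ₗ
    LinearMap.mulLeft (ModGroupRing u) ((normOneUnit hν ^ (-(i / r)) : (ExtAlg u L)ˣ) : ExtAlg u L)
    else 0

theorem periodicDegZero_of_dvd {i : ℤ} (hi : (r : ℤ) ∣ i) {p : ExtAlg u L} (hp : p ∈ gr u L i) :
    periodicDegZero hν p =
      degZero u L ((normOneUnit hν ^ (-(i / r)) : (ExtAlg u L)ˣ) * p) := by
  rw [periodicDegZero, assemble_apply u L _ hp, if_pos hi]
  rfl

theorem periodicDegZero_of_not_dvd {i : ℤ} (hi : ¬ (r : ℤ) ∣ i) {p : ExtAlg u L}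
    (hp : p ∈ gr u L i) : periodicDegZero hν p = 0 := by
  rw [periodicDegZero, assemble_apply u L _ hp, if_neg hi, LinearMap.zero_apply]

theorem periodicDegZero_of_mem {p : ExtAlg u L} (hp : p ∈ gr u L 0) :
    periodicDegZero hν p = degZero u L p := by
  rw [periodicDegZero_of_dvd hν (dvd_zero _) hp]
  simp

/-- Multiplication by ν raises the degree by r, and the shift to degree zero then uses one more
factor ν⁻¹. Hence the map kills the ideal generated by ν - 1. -/
theorem periodicDegZero_incl_mul (hr : 0 < r) (p : ExtAlg u L) :
    periodicDegZero hν (incl u L r ν * p) = periodicDegZero hν p := by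
  have hp : p ∈ ⨆ i, gr u L i := iSup_gr u L ▸ Submodule.mem_top
  have hr0 : (r : ℤ) ≠ 0 := by exact_mod_cast hr.ne'
  induction hp using Submodule.iSup_induction' with
  | mem i p hp =>
    have hmem : incl u L r ν * p ∈ gr u L (r + i) := mul_mem_gr u L (incl_mem_gr ν) hp
    by_cases hi : (r : ℤ) ∣ i
    · rw [periodicDegZero_of_dvd hν hi hp,
        periodicDegZero_of_dvd hν ((dvd_add_right (dvd_refl _)).2 hi) hmem]
      congr 1
      have h : -((r + i) / (r : ℤ)) = -(i / r) - 1 := by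
        rw [Int.add_ediv_of_dvd_left (dvd_refl _), Int.ediv_self hr0]
        ring
      rw [h, zpow_sub_one, Units.val_mul, mul_assoc]
      congr 1
      exact Units.inv_mul_cancel_left (normOneUnit hν) p
    · rw [periodicDegZero_of_not_dvd hν hi hp, periodicDegZero_of_not_dvd hν
        (fun h => hi ((dvd_add_right (dvd_refl _)).1 h)) hmem]
  | zero => rw [mul_zero]
  | add p q _ _ hp hq => rw [mul_add, map_add, map_add, hp, hq]

/-- The trace on the quotient, pulled back to the extended tensor algebra. -/
def periodicTrace : ExtAlg u L →+ ℤ :=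
  (ModGroupRing.trace u).comp (periodicDegZero hν).toAddMonoidHom

theorem periodicTrace_eq_of_toQuot_eq (hr : 0 < r) {p q : ExtAlg u L}
    (h : toQuot u ν p = toQuot u ν q) : periodicTrace hν p = periodicTrace hν q := by
  obtain ⟨c, hc⟩ := toQuot_eq_iff.1 h
  have h1 : periodicTrace hν (incl u L r ν * c) = periodicTrace hν c :=
    congrArg (ModGroupRing.trace u) (periodicDegZero_incl_mul hν hr c)
  rw [← sub_eq_zero, ← map_sub, ← hc, mul_sub, mul_one, map_sub, mul_comm, h1, sub_self]

theorem periodicTrace_of_not_dvd {i : ℤ} (hi : ¬ (r : ℤ) ∣ i) {p : ExtAlg u L}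
    (hp : p ∈ gr u L i) : periodicTrace hν p = 0 :=
  (congrArg _ (periodicDegZero_of_not_dvd hν hi hp)).trans (map_zero _)

theorem periodicTrace_of_mem {p : ExtAlg u L} (hp : p ∈ gr u L 0) :
    periodicTrace hν p = tr u L p :=
  congrArg _ (periodicDegZero_of_mem hν hp)

theorem periodicTrace_one : periodicTrace hν 1 = 1 := by
  rw [periodicTrace_of_mem hν (one_mem_gr u L), ← map_one (algebraMap (ModGroupRing u) _),
    tr_algebraMap, ModGroupRing.trace_one]

/-- A cross term has degree i - j with 0 < |i - j| < r, which r does not divide. So distinct pieces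
are orthogonal. -/
theorem periodicTrace_sum (a : ℕ → ExtAlg u L) (ha : ∀ i : ℕ, a i ∈ gr u L i) :
    periodicTrace hν ((∑ i ∈ Finset.range r, a i) * star u L (∑ i ∈ Finset.range r, a i)) =
      ∑ i ∈ Finset.range r, tr u L (a i * star u L (a i)) := by
  rw [map_sum, Finset.sum_mul_sum, map_sum]
  refine Finset.sum_congr rfl fun i hi => ?_
  rw [map_sum, Finset.sum_eq_single_of_mem i hi]
  · exact periodicTrace_of_mem hν (mul_star_mem u L (ha i) (ha i))
  · intro j hj hij
    refine periodicTrace_of_not_dvd hν ?_ (mul_mem_gr u L (ha i) (star_mem_gr u L (ha j)))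
    rw [Finset.mem_range] at hi hj
    intro hd
    have := Int.eq_zero_of_abs_lt_dvd hd (by rw [abs_lt]; omega)
    omega

theorem eq_zero_of_periodicTrace (a : ℕ → ExtAlg u L) (ha : ∀ i : ℕ, a i ∈ gr u L i)
    (h : periodicTrace hν
      ((∑ i ∈ Finset.range r, a i) * star u L (∑ i ∈ Finset.range r, a i)) = 0) :
    ∀ i < r, a i = 0 := by
  rw [periodicTrace_sum hν a ha, Finset.sum_eq_zero_iff_of_nonneg
    fun i _ => (tr_mul_star_posDef u L i (ha i)).1] at h
  exact fun i hi => (tr_mul_star_posDef u L i (ha i)).2 (h i (Finset.mem_range.2 hi))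

include hν in
-- Multiply by the power of ν, possibly negative, that accounts for the difference of the degrees.
theorem exists_toQuot_eq (i : ℤ) {j : ℤ} (hij : (j : ZMod r) = i) {p : ExtAlg u L}
    (hp : p ∈ gr u L j) : ∃ q ∈ gr u L i, toQuot u ν q = toQuot u ν p := by
  rw [ZMod.intCast_eq_intCast_iff_dvd_sub] at hij
  obtain ⟨k, hk⟩ := hij
  refine ⟨_, ?_, toQuot_zpow_mul hν k p⟩
  convert mul_mem_gr u L (normOneUnit_zpow_mem hν k) hp using 2
  linear_combination hk

include hν in
theorem exists_sum_eq (hr : 0 < r) (p : ExtAlg u L) :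
    ∃ a : ℕ → ExtAlg u L, (∀ i : ℕ, a i ∈ gr u L i) ∧
      toQuot u ν p = toQuot u ν (∑ i ∈ Finset.range r, a i) := by
  have hp : p ∈ ⨆ i, gr u L i := iSup_gr u L ▸ Submodule.mem_top
  induction hp using Submodule.iSup_induction' with
  | mem j p hp =>
    have := NeZero.of_pos hr
    obtain ⟨q, hq, hqp⟩ := exists_toQuot_eq hν ((j : ZMod r).val : ℤ) (j := j) (by simp) hp
    refine ⟨fun i => if i = (j : ZMod r).val then q else 0, fun i => ?_, ?_⟩
    · dsimp only
      split_ifs with h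
      · rw [h]; exact hq
      · exact zero_mem _
    · rw [Finset.sum_ite_eq', if_pos (Finset.mem_range.2 (ZMod.val_lt _)), hqp]
  | zero => exact ⟨0, fun i => zero_mem _, by simp⟩
  | add p q _ _ hp hq =>
    obtain ⟨a, ha, hpa⟩ := hp
    obtain ⟨b, hb, hqb⟩ := hq
    exact ⟨a + b, fun i => add_mem (ha i) (hb i), by
      simp only [Pi.add_apply, Finset.sum_add_distrib, map_add, hpa, hqb]⟩

/-- The trace form on the quotient is positive definite. -/
theorem periodicTrace_posDef (hr : 0 < r) (p : ExtAlg u L) :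
    0 ≤ periodicTrace hν (p * star u L p) ∧
      (periodicTrace hν (p * star u L p) = 0 → toQuot u ν p = 0) := by
  obtain ⟨a, ha, hpa⟩ := exists_sum_eq hν hr p
  have h : periodicTrace hν (p * star u L p) = periodicTrace hν
      ((∑ i ∈ Finset.range r, a i) * star u L (∑ i ∈ Finset.range r, a i)) := by
    refine periodicTrace_eq_of_toQuot_eq hν hr ?_
    rw [map_mul, map_mul, hpa, toQuot_star hν hpa]
  rw [h]
  refine ⟨?_, fun h0 => ?_⟩
  · rw [periodicTrace_sum hν a ha]
    exact Finset.sum_nonneg fun i _ => (tr_mul_star_posDef u L i (ha i)).1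
  · rw [hpa, Finset.sum_eq_zero fun i hi =>
      eq_zero_of_periodicTrace hν a ha h0 i (Finset.mem_range.1 hi), map_zero]

include hν in
/-- Roots of unity have norm `1`. -/
theorem toQuot_mul_star_eq_one (hr : 0 < r) {p : ExtAlg u L} {k : ℕ} (hk : 0 < k)
    (hp : toQuot u ν p ^ k = 1) : toQuot u ν (p * star u L p) = 1 := by
  have hs : toQuot u ν (star u L p) ^ k = 1 := by
    rw [← map_pow, ← map_pow, toQuot_star hν (q := 1) (by rw [map_pow, hp, map_one]), map_one,
      map_one]
  set s := p * star u L p with hs_def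
  have hgeom : toQuot u ν ((∑ i ∈ Finset.range k, s ^ i) * (s - 1)) = 0 := by
    rw [geom_sum_mul, map_sub, map_pow, hs_def, map_mul, mul_pow, hp, hs, map_one, mul_one, sub_self]
  -- Multiply the geometric sum by the conjugate of s - 1. Since s^i = p^i p̄^i, each term becomes
  -- the norm of p^i (s - 1). These norms are nonnegative with sum zero, and the one with i = 0
  -- gives s = 1 in A.
  have hsum : ∑ i ∈ Finset.range k,
      periodicTrace hν ((p ^ i * (s - 1)) * star u L (p ^ i * (s - 1))) = 0 := by
    have h : ∑ i ∈ Finset.range k, (p ^ i * (s - 1)) * star u L (p ^ i * (s - 1)) =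
        (∑ i ∈ Finset.range k, s ^ i) * (s - 1) * star u L (s - 1) := by
      rw [Finset.sum_mul, Finset.sum_mul]
      refine Finset.sum_congr rfl fun i _ => ?_
      rw [map_mul, map_pow, hs_def, mul_pow]
      ring
    rw [← map_sum, h, ← map_zero (periodicTrace hν)]
    refine periodicTrace_eq_of_toQuot_eq hν hr ?_
    rw [map_mul, hgeom, zero_mul, map_zero]
  rw [Finset.sum_eq_zero_iff_of_nonneg fun i _ => (periodicTrace_posDef hν hr _).1] at hsum
  have h0 := hsum 0 (Finset.mem_range.2 hk)
  rw [pow_zero, one_mul] at h0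
  have := (periodicTrace_posDef hν hr _).2 h0
  rwa [map_sub, map_one, sub_eq_zero] at this

include hν in
-- The product p p̄ has degree zero, so its trace can be read off in A. No bound m < r is needed,
-- which matters for L itself when r = 1.
theorem eq_zero_of_toQuot_eq_zero (hr : 0 < r) {m : ℕ} {p : ExtAlg u L} (hp : p ∈ gr u L m)
    (h : toQuot u ν p = 0) : p = 0 := by
  refine (tr_mul_star_posDef u L m hp).2 ?_
  rw [← periodicTrace_of_mem hν (mul_star_mem u L hp hp), ← map_zero (periodicTrace hν)]
  exact periodicTrace_eq_of_toQuot_eq hν hr (by rw [map_mul, h, zero_mul, map_zero])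

include hν in
theorem eq_of_toQuot_eq (hr : 0 < r) {m : ℕ} {p q : ExtAlg u L} (hp : p ∈ gr u L m)
    (hq : q ∈ gr u L m) (h : toQuot u ν p = toQuot u ν q) : p = q :=
  sub_eq_zero.1 (eq_zero_of_toQuot_eq_zero hν hr (sub_mem hp hq) (by rw [map_sub, h, sub_self]))

include hν in
/-- Roots of unity are homogeneous. -/
theorem exists_homogeneous (hr : 0 < r) {ζ : RootRing u ν} {k : ℕ} (hk : 0 < k) (hζ : ζ ^ k = 1) :
    ∃ i < r, ∃ a ∈ gr u L i, a * star u L a = 1 ∧ toQuot u ν a = ζ := by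
  obtain ⟨p, rfl⟩ := toQuot_surjective ζ
  obtain ⟨a, ha, hpa⟩ := exists_sum_eq hν hr p
  rw [hpa] at hζ ⊢
  have h1 := toQuot_mul_star_eq_one hν hr hk hζ
  have hsum := periodicTrace_sum hν a ha
  rw [periodicTrace_eq_of_toQuot_eq hν hr (h1.trans (map_one _).symm), periodicTrace_one] at hsum
  have hnn (i : ℕ) := (tr_mul_star_posDef u L i (ha i)).1
  -- The norms of the components are nonnegative integers with sum 1, so exactly one of them is
  -- nonzero.
  obtain ⟨i, hi, hai⟩ : ∃ i ∈ Finset.range r, tr u L (a i * star u L (a i)) ≠ 0 := by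
    by_contra! h
    rw [Finset.sum_eq_zero h] at hsum
    omega
  have hz : ∀ j ∈ Finset.range r, j ≠ i → a j = 0 := by
    intro j hj hji
    refine (tr_mul_star_posDef u L j (ha j)).2 ?_
    have h2 := Finset.add_le_sum (fun j _ => hnn j) hi hj hji.symm
    have := hnn i
    have := hnn j
    omega
  rw [Finset.sum_eq_single_of_mem i hi hz] at h1 ⊢
  refine ⟨i, Finset.mem_range.1 hi, a i, ha i, ?_, rfl⟩
  exact eq_of_toQuot_eq hν hr (m := 0) (mul_star_mem u L (ha i) (ha i)) (one_mem_gr u L)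
    (h1.trans (map_one _).symm)

theorem exists_of_eq_of_mul_star {a : ExtAlg u L} (ha : a ∈ gr u L 0) (h : a * star u L a = 1) :
    ∃ σ : G, algebraMap _ _ (ModGroupRing.of u σ) = a := by
  obtain ⟨g, rfl⟩ := exists_algebraMap u L ha
  rw [star_algebraMap, ← map_mul, ← map_one (algebraMap (ModGroupRing u) (ExtAlg u L))] at h
  have h1 := algebraMap_injective u L h
  obtain ⟨σ, rfl⟩ := ModGroupRing.exists_of_eq (by rw [h1, ModGroupRing.trace_one])
  exact ⟨σ, rfl⟩

include hν in
/-- A vector of lifted norm `1` is a root of unity. -/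
theorem isOfFinOrder_toQuot (hr : 0 < r) {m : ℕ} {a : ExtAlg u L} (ha : a ∈ gr u L m)
    (h : a * star u L a = 1) : IsOfFinOrder (toQuot u ν a) := by
  -- The degree rm of a^r is divisible by r. Shifted to degree zero, a^r still has norm one and so
  -- comes from the finite group G.
  obtain ⟨b, hb, hba⟩ := exists_toQuot_eq hν 0 (by simp) (pow_mem_gr u L ha r)
  have hbs : b * star u L b = 1 := by
    refine eq_of_toQuot_eq hν hr (m := 0) (mul_star_mem u L hb hb) (one_mem_gr u L) ?_
    rw [map_mul, hba, toQuot_star hν hba, ← map_mul, map_pow, ← mul_pow, h, one_pow]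
  obtain ⟨σ, rfl⟩ := exists_of_eq_of_mul_star hb hbs
  rw [map_pow] at hba
  have hfin : IsOfFinOrder (toQuot u ν a ^ r) := by
    rw [← hba]
    exact (((toQuot u ν : ExtAlg u L →* RootRing u ν).comp
      (algebraMap (ModGroupRing u) (ExtAlg u L) : _ →* _)).comp
        (ModGroupRing.of u)).isOfFinOrder (isOfFinOrder_of_finite σ)
  exact hfin.of_pow hr.ne'

include hν in
-- In A the product p q̄ equals p p̄ = 1 and has trace 1, whereas the trace vanishes in degrees not
-- divisible by r. So the degree of a norm-one element is well defined modulo r.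
theorem dvd_sub_of_toQuot_eq (hr : 0 < r) {i j : ℤ} {p q : ExtAlg u L} (hp : p ∈ gr u L i)
    (hq : q ∈ gr u L j) (h : toQuot u ν p = toQuot u ν q) (h1 : p * star u L p = 1) :
    (r : ℤ) ∣ i - j := by
  by_contra hd
  have h2 := periodicTrace_of_not_dvd hν hd (mul_mem_gr u L hp (star_mem_gr u L hq))
  rw [periodicTrace_eq_of_toQuot_eq hν hr (q := 1) (by
    rw [map_mul, ← toQuot_star hν h, ← map_mul, h1]), periodicTrace_one] at h2
  omega

end Quotient

end GLattice

end

/-! ### The ring A, its roots of unity and the degree map. -/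

noncomputable section

namespace GLattice

open IntegralLattice
open Conj (conj)

variable {G : Type*} [CommGroup G] [Finite G] {u : G} {L : Type*}
  [AddCommGroup L] [IntegralLattice L] [DistribMulAction G L] [GLattice u L] [IsInvertible u L]
  {r : ℕ} {ν : ⨂[ModGroupRing u]^r L}

theorem latticeToRootRing_apply (x : L) : latticeToRootRing u ν x = toQuot u ν (ι u L x) := rfl

theorem groupToUnits_apply (σ : G) : ((groupToUnits u ν σ : (RootRing u ν)ˣ) : RootRing u ν) =
    toQuot u ν (algebraMap _ _ (ModGroupRing.of u σ)) := rfl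

theorem mem_range_toRootRing {i : ℕ} {ζ : RootRing u ν} :
    ζ ∈ LinearMap.range (toRootRing u ν i) ↔ ∃ a ∈ gr u L i, toQuot u ν a = ζ := by
  constructor
  · rintro ⟨z, rfl⟩
    exact ⟨_, incl_mem_gr z, rfl⟩
  · rintro ⟨_, ⟨z, rfl⟩, rfl⟩
    exact ⟨z, rfl⟩

theorem incl_injective (i : ℕ) : Function.Injective (incl u L i) :=
  DirectSum.of_injective (β := ExtTensor.Pow (ModGroupRing u) L (Conj L)) (Int.ofNat i)

attribute [local irreducible] instCommRingExtAlgOfIsInvertible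

theorem ι_mem_gr (x : L) : ι u L x ∈ gr u L 1 := by
  simpa using prod_ι_mem u L 1 fun _ => x

theorem exists_ι_eq {p : ExtAlg u L} (hp : p ∈ gr u L 1) : ∃ x, ι u L x = p := by
  have h : gr u L 1 ≤ LinearMap.range (ι u L) := by
    refine gr_natCast_le u L 1 _ fun z => ?_
    rw [Fin.prod_univ_one]
    exact ⟨_, rfl⟩
  exact h hp

variable [Fact (orderOf u = 2)] (hν : incl u L r ν * star u L (incl u L r ν) = 1)

include hν

/-- Frees the pieces of A from the representative in [0, r), so that degrees can be added in ℤ. -/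
theorem mem_piece_iff (hr : 0 < r) (i : ℤ) {ζ : RootRing u ν} :
    ζ ∈ piece u ν (i : ZMod r) ↔ ∃ a ∈ gr u L i, toQuot u ν a = ζ := by
  have := NeZero.of_pos hr
  rw [piece, mem_range_toRootRing]
  constructor
  · rintro ⟨a, ha, rfl⟩
    exact exists_toQuot_eq hν i (by simp) ha
  · rintro ⟨a, ha, rfl⟩
    exact exists_toQuot_eq hν _ (by simp) ha

theorem gradedMonoid_piece (hr : 0 < r) : SetLike.GradedMonoid (piece u ν) where
  one_mem := by
    have h := (mem_piece_iff hν hr 0 (ζ := 1)).2 ⟨1, one_mem_gr u L, map_one _⟩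
    simpa using h
  mul_mem := by
    intro i j x y hx hy
    obtain ⟨i, rfl⟩ := ZMod.intCast_surjective i
    obtain ⟨j, rfl⟩ := ZMod.intCast_surjective j
    obtain ⟨a, ha, rfl⟩ := (mem_piece_iff hν hr i).1 hx
    obtain ⟨b, hb, rfl⟩ := (mem_piece_iff hν hr j).1 hy
    rw [← Int.cast_add]
    exact (mem_piece_iff hν hr _).2 ⟨a * b, mul_mem_gr u L ha hb, map_mul _ _ _⟩

/-- Injectivity is orthogonality and definiteness of the trace form; surjectivity is folding degrees
modulo r. -/
theorem sumToRootRing_bijective (hr : 0 < r) : Function.Bijective (sumToRootRing u ν) := by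
  have happly (z : ∀ i : Fin r, ⨂[ModGroupRing u]^(i : ℕ) L) :
      sumToRootRing u ν (∑ i : Fin r, DirectSum.lof (ModGroupRing u) (Fin r)
        (fun i : Fin r => ⨂[ModGroupRing u]^(i : ℕ) L) i (z i)) =
      ∑ i : Fin r, toQuot u ν (incl u L i (z i)) := by
    rw [map_sum]
    exact Finset.sum_congr rfl fun i _ => DirectSum.toModule_lof _ _ _
  constructor
  · rw [injective_iff_map_eq_zero]
    intro x hx
    have hxs : x = ∑ i : Fin r, DirectSum.lof (ModGroupRing u) (Fin r)
        (fun i : Fin r => ⨂[ModGroupRing u]^(i : ℕ) L) i (x i) :=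
      (DirectSum.sum_univ_of x).symm
    let a : ℕ → ExtAlg u L := fun i => if h : i < r then incl u L i (x ⟨i, h⟩) else 0
    have ha (i : ℕ) : a i ∈ gr u L i := by
      by_cases h : i < r
      · simp only [a, h, dif_pos]
        exact incl_mem_gr _
      · simp only [a, h, dif_neg, not_false_eq_true]
        exact zero_mem _
    have hax (i : Fin r) : a i = incl u L i (x i) := by
      simp only [a, i.2, dif_pos]
    rw [hxs, happly, ← map_sum] at hx
    simp only [← hax] at hx
    rw [Fin.sum_univ_eq_sum_range a r] at hx
    have h0 := eq_zero_of_periodicTrace hν a ha (by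
      rw [← map_zero (periodicTrace hν)]
      exact periodicTrace_eq_of_toQuot_eq hν hr (by rw [map_mul, hx, zero_mul, map_zero]))
    rw [hxs]
    refine Finset.sum_eq_zero fun i _ => ?_
    have hi : x i = 0 := incl_injective (i : ℕ) (by rw [← hax, h0 i i.2, map_zero])
    rw [hi, map_zero]
  · intro y
    obtain ⟨p, rfl⟩ := toQuot_surjective y
    obtain ⟨a, ha, hp⟩ := exists_sum_eq hν hr p
    choose z hz using fun i : ℕ => ha i
    refine ⟨_, (happly fun i => z i).trans ?_⟩
    rw [hp, ← Fin.sum_univ_eq_sum_range a r, map_sum]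
    exact Finset.sum_congr rfl fun i _ => congrArg _ (hz i)

theorem latticeToRootRing_injective (hr : 0 < r) : Function.Injective (latticeToRootRing u ν) := by
  rw [injective_iff_map_eq_zero]
  intro x hx
  rw [latticeToRootRing_apply] at hx
  have h := eq_zero_of_toQuot_eq_zero hν hr (m := 1) (ι_mem_gr x) hx
  rw [← map_zero (ι u L), ι_apply, ι_apply] at h
  have h2 := incl_injective 1 h
  rw [← subsingletonEquiv_symm_apply', ← subsingletonEquiv_symm_apply'] at h2
  exact (LinearEquiv.injective _) h2

theorem groupToUnits_injective (hr : 0 < r) : Function.Injective (groupToUnits u ν) := by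
  intro σ τ h
  have h2 := congrArg (fun ζ : (RootRing u ν)ˣ => (ζ : RootRing u ν)) h
  simp only [groupToUnits_apply] at h2
  exact ModGroupRing.of_injective (algebraMap_injective u L
    (eq_of_toQuot_eq hν hr (m := 0) (algebraMap_mem_gr u L _) (algebraMap_mem_gr u L _) h2))

theorem exists_homogeneous_of_mem (hr : 0 < r) {ζ : (RootRing u ν)ˣ}
    (hζ : ζ ∈ rootsOfUnityGroup (RootRing u ν)) :
    ∃ i < r, ∃ a ∈ gr u L i, a * star u L a = 1 ∧ toQuot u ν a = ζ := by
  obtain ⟨k, hk, h⟩ := isOfFinOrder_iff_pow_eq_one.1 ((CommGroup.mem_torsion _).1 hζ)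
  exact exists_homogeneous hν hr hk (by rw [← Units.val_pow_eq_pow_val, h, Units.val_one])

theorem exists_mem_rootsOfUnityGroup (hr : 0 < r) {m : ℕ} {a : ExtAlg u L} (ha : a ∈ gr u L m)
    (h : a * star u L a = 1) :
    ∃ ζ ∈ rootsOfUnityGroup (RootRing u ν), (ζ : RootRing u ν) = toQuot u ν a := by
  have hfin := isOfFinOrder_toQuot hν hr ha h
  refine ⟨hfin.unit, ?_, rfl⟩
  rw [CommGroup.mem_torsion, ← Units.isOfFinOrder_val]
  exact hfin

theorem eq_of_mem_piece (hr : 0 < r) {ζ : (RootRing u ν)ˣ}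
    (hζ : ζ ∈ rootsOfUnityGroup (RootRing u ν)) {i j : ZMod r} (hi : (ζ : RootRing u ν) ∈ piece u ν i)
    (hj : (ζ : RootRing u ν) ∈ piece u ν j) : i = j := by
  obtain ⟨k, -, a, ha, h1, haζ⟩ := exists_homogeneous_of_mem hν hr hζ
  have key (l : ZMod r) (hl : (ζ : RootRing u ν) ∈ piece u ν l) : ((k : ℤ) : ZMod r) = l := by
    obtain ⟨l, rfl⟩ := ZMod.intCast_surjective l
    obtain ⟨b, hb, hbζ⟩ := (mem_piece_iff hν hr l).1 hl
    have := dvd_sub_of_toQuot_eq hν hr ha hb (haζ.trans hbζ.symm) h1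
    exact ((ZMod.intCast_eq_intCast_iff_dvd_sub _ _ _).2 this).symm
  rw [← key i hi, key j hj]

theorem exists_mem_piece (hr : 0 < r) {ζ : (RootRing u ν)ˣ}
    (hζ : ζ ∈ rootsOfUnityGroup (RootRing u ν)) : ∃ j, (ζ : RootRing u ν) ∈ piece u ν j := by
  obtain ⟨k, -, a, ha, h1, haζ⟩ := exists_homogeneous_of_mem hν hr hζ
  exact ⟨_, (mem_piece_iff hν hr k).2 ⟨a, ha, haζ⟩⟩

/-- The degree map on the roots of unity. -/
theorem exists_degree (hr : 0 < r) :
    ∃ deg : rootsOfUnityGroup (RootRing u ν) →* Multiplicative (ZMod r),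
      ∀ (ζ : rootsOfUnityGroup (RootRing u ν)) (j : ZMod r), (deg ζ).toAdd = j ↔
        ((ζ : (RootRing u ν)ˣ) : RootRing u ν) ∈ piece u ν j := by
  choose d hd using fun ζ : rootsOfUnityGroup (RootRing u ν) => exists_mem_piece hν hr ζ.2
  have := gradedMonoid_piece hν hr
  refine ⟨MonoidHom.mk' (fun ζ => Multiplicative.ofAdd (d ζ)) fun ζ ξ => ?_, fun ζ j => ?_⟩
  · rw [← ofAdd_add]
    exact congrArg _ (eq_of_mem_piece hν hr (ζ * ξ).2 (hd _)
      (SetLike.GradedMul.mul_mem (hd ζ) (hd ξ)))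
  · constructor
    · rintro rfl
      exact hd ζ
    · exact eq_of_mem_piece hν hr ζ.2 (hd ζ)

omit hν [Fact (orderOf u = 2)] in
theorem range_groupToUnits_le :
    (groupToUnits u ν).range ≤ rootsOfUnityGroup (RootRing u ν) := by
  rintro _ ⟨σ, rfl⟩
  exact (CommGroup.mem_torsion _).2 ((groupToUnits u ν).isOfFinOrder (isOfFinOrder_of_finite σ))

theorem setOf_dot_eq_one (hr : 0 < r) : {e : L | dot u L e (conj e) = 1} =
    {e : L | ∃ ζ ∈ rootsOfUnityGroup (RootRing u ν),
      (ζ : RootRing u ν) = latticeToRootRing u ν e} := by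
  ext e
  have hdot : ι u L e * star u L (ι u L e) = algebraMap _ _ (dot u L e (conj e)) := by
    rw [star_ι, ι_mul_ιConj]
  constructor
  · intro h
    exact exists_mem_rootsOfUnityGroup hν hr (m := 1) (ι_mem_gr e)
      (hdot.trans ((congrArg _ h).trans (map_one _)))
  · rintro ⟨ζ, hζ, hζe⟩
    obtain ⟨k, hk, h⟩ := isOfFinOrder_iff_pow_eq_one.1 ((CommGroup.mem_torsion _).1 hζ)
    -- The equation e ē = 1 first holds in A; it lifts to Λ because the degree-zero part embeds in
    -- A.
    have h1 := toQuot_mul_star_eq_one hν hr (p := ι u L e) hk (by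
      rw [← latticeToRootRing_apply, ← hζe, ← Units.val_pow_eq_pow_val, h, Units.val_one])
    have h2 := eq_of_toQuot_eq hν hr (m := 0) (mul_star_mem u L (ι_mem_gr e) (ι_mem_gr e))
      (one_mem_gr u L) (h1.trans (map_one _).symm)
    refine algebraMap_injective u L ?_
    rw [← hdot, h2, map_one]

/-- The kernel of the degree map is G: a root of unity of degree zero is represented by a norm-one
element of ℤ⟨G⟩. -/
theorem card_rootsOfUnityGroup (hr : 0 < r)
    (deg : rootsOfUnityGroup (RootRing u ν) →* Multiplicative (ZMod r))
    (hdeg : ∀ (ζ : rootsOfUnityGroup (RootRing u ν)) (j : ZMod r), (deg ζ).toAdd = j ↔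
      ((ζ : (RootRing u ν)ˣ) : RootRing u ν) ∈ piece u ν j) :
    Nat.card (rootsOfUnityGroup (RootRing u ν)) = Nat.card G * Nat.card deg.range := by
  rw [← Subgroup.card_mul_index deg.ker, Subgroup.index_ker]
  congr 1
  have hmem (σ : G) : groupToUnits u ν σ ∈ rootsOfUnityGroup (RootRing u ν) :=
    range_groupToUnits_le ⟨σ, rfl⟩
  refine (Nat.card_eq_of_bijective (fun σ : G => (⟨⟨groupToUnits u ν σ, hmem σ⟩, ?_⟩ : deg.ker))
    ⟨fun σ τ h => ?_, ?_⟩).symm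
  · rw [MonoidHom.mem_ker, ← Multiplicative.toAdd.injective.eq_iff]
    refine (hdeg _ _).2 ?_
    have h := (mem_piece_iff hν hr 0 (ζ := groupToUnits u ν σ)).2
      ⟨_, algebraMap_mem_gr u L _, (groupToUnits_apply σ).symm⟩
    simpa using h
  · simp only [Subtype.mk.injEq] at h
    exact groupToUnits_injective hν hr h
  · rintro ⟨⟨ζ, hζ⟩, hker⟩
    rw [MonoidHom.mem_ker, ← Multiplicative.toAdd.injective.eq_iff] at hker
    obtain ⟨a, ha, haζ⟩ := (mem_piece_iff hν hr 0).1 (by simpa using (hdeg _ _).1 hker)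
    obtain ⟨i, hi, b, hb, h1, hbζ⟩ := exists_homogeneous_of_mem hν hr hζ
    -- The homogeneous representative has degree i < r, and degree zero in ℤ/rℤ gives r ∣ i, so i =
    -- 0 and the representative lies in ℤ⟨G⟩.
    have hd := dvd_sub_of_toQuot_eq hν hr hb ha (hbζ.trans haζ.symm) h1
    rw [sub_zero, Int.natCast_dvd_natCast] at hd
    obtain rfl := Nat.eq_zero_of_dvd_of_lt hd hi
    obtain ⟨σ, rfl⟩ := exists_of_eq_of_mul_star hb h1
    exact ⟨σ, Subtype.ext (Subtype.ext (Units.ext hbζ))⟩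

theorem surjective_degree_iff (hr : 0 < r)
    (deg : rootsOfUnityGroup (RootRing u ν) →* Multiplicative (ZMod r))
    (hdeg : ∀ (ζ : rootsOfUnityGroup (RootRing u ν)) (j : ZMod r), (deg ζ).toAdd = j ↔
      ((ζ : (RootRing u ν)ˣ) : RootRing u ν) ∈ piece u ν j) :
    Function.Surjective deg ↔ ∃ ζ ∈ rootsOfUnityGroup (RootRing u ν),
      (ζ : RootRing u ν) ∈ LinearMap.range (latticeToRootRing u ν) := by
  have hone (ζ : RootRing u ν) : ζ ∈ piece u ν 1 ↔
      ζ ∈ LinearMap.range (latticeToRootRing u ν) := by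
    have h := mem_piece_iff hν hr 1 (ζ := ζ)
    rw [Int.cast_one] at h
    rw [h]
    constructor
    · rintro ⟨a, ha, rfl⟩
      obtain ⟨x, rfl⟩ := exists_ι_eq ha
      exact ⟨x, rfl⟩
    · rintro ⟨x, rfl⟩
      exact ⟨_, ι_mem_gr x, rfl⟩
  constructor
  · intro h
    obtain ⟨ζ, hζ⟩ := h (Multiplicative.ofAdd 1)
    exact ⟨ζ, ζ.2, (hone _).1 ((hdeg ζ 1).1 (by rw [hζ, toAdd_ofAdd]))⟩
  · rintro ⟨ζ, hζ, h⟩ j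
    have := NeZero.of_pos hr
    have h1 := (hdeg ⟨ζ, hζ⟩ 1).2 ((hone _).2 h)
    -- An element of degree 1 has powers of every degree.
    refine ⟨⟨ζ, hζ⟩ ^ j.toAdd.val, ?_⟩
    rw [map_pow, ← Multiplicative.toAdd.injective.eq_iff, toAdd_pow, h1, nsmul_one,
      ZMod.natCast_zmod_val]

end GLattice

end

theorem mainTheorem9 {G : Type*} [CommGroup G] [Finite G] (u : G) [Fact (orderOf u = 2)]
    (n : ℕ) (hn : Nat.card G = 2 * n)
    {L : Type*} [AddCommGroup L] [IntegralLattice L] [DistribMulAction G L] [GLattice u L]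
    [IsInvertible u L]
    (r : ℕ) (hr : 0 < r) (ν : ⨂[ModGroupRing u]^r L) (hν : IsShort u ν) :
    -- `A = ⨁_{0 ≤ i < r} L^i` is a `ℤ/rℤ`-graded ring, and `L` and `G` embed in it
    Function.Bijective (sumToRootRing u ν) ∧
    SetLike.GradedMonoid (piece u ν) ∧
    Function.Injective (latticeToRootRing u ν) ∧
    Function.Injective (groupToUnits u ν) ∧
    -- `G ⊆ μ(A) ⊆ ⋃ L^i`
    (groupToUnits u ν).range ≤ rootsOfUnityGroup (RootRing u ν) ∧
    (∀ ζ ∈ rootsOfUnityGroup (RootRing u ν), ∃ i : ℕ, i < r ∧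
      (ζ : RootRing u ν) ∈ LinearMap.range (toRootRing u ν i)) ∧
    -- `{e ∈ L : e · ē = 1} = μ(A) ∩ L`
    {e : L | dot u L e (Conj.conj e) = 1} =
      {e : L | ∃ ζ ∈ rootsOfUnityGroup (RootRing u ν),
        (ζ : RootRing u ν) = latticeToRootRing u ν e} ∧
    -- the order of `μ(A)`
    2 * n ∣ Nat.card (rootsOfUnityGroup (RootRing u ν)) ∧
    Nat.card (rootsOfUnityGroup (RootRing u ν)) ∣ 2 * n * r ∧
    -- the degree map
    (∃ deg : rootsOfUnityGroup (RootRing u ν) → ZMod r,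
      (∀ (ζ : rootsOfUnityGroup (RootRing u ν)) (j : ZMod r),
        deg ζ = j ↔ ((ζ : (RootRing u ν)ˣ) : RootRing u ν) ∈ piece u ν j) ∧
      (Function.Surjective deg ↔ ∃ ζ ∈ rootsOfUnityGroup (RootRing u ν),
        (ζ : RootRing u ν) ∈ LinearMap.range (latticeToRootRing u ν))) ∧
    -- equality
    ((∃ e : L, dot u L e (Conj.conj e) = 1) ↔
      Nat.card (rootsOfUnityGroup (RootRing u ν)) = 2 * n * r) := by
  have hV := incl_mul_star_of_isShort u hν
  obtain ⟨deg, hdeg⟩ := exists_degree hV hr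
  have := NeZero.of_pos hr
  have hcard := card_rootsOfUnityGroup hV hr deg hdeg
  have hsurj := surjective_degree_iff hV hr deg hdeg
  have hZ : Nat.card (Multiplicative (ZMod r)) = r := by
    rw [Nat.card_congr Multiplicative.toAdd, Nat.card_zmod]
  have hpos : 0 < 2 * n := hn ▸ Nat.card_pos
  rw [hn] at hcard
  refine ⟨sumToRootRing_bijective hV hr, gradedMonoid_piece hV hr,
    latticeToRootRing_injective hV hr, groupToUnits_injective hV hr, range_groupToUnits_le,
    fun ζ hζ => ?_, setOf_dot_eq_one hV hr, ⟨_, hcard⟩, ?_,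
    ⟨fun ζ => (deg ζ).toAdd, hdeg, (Multiplicative.toAdd.surjective_comp (f := deg)).trans hsurj⟩, ?_⟩
  · obtain ⟨i, hi, a, ha, -, haζ⟩ := exists_homogeneous_of_mem hV hr hζ
    exact ⟨i, hi, mem_range_toRootRing.2 ⟨a, ha, haζ⟩⟩
  · rw [hcard]
    refine mul_dvd_mul_left _ ?_
    conv_rhs => rw [← hZ]
    exact Subgroup.card_subgroup_dvd_card _
  -- A norm-one vector of L is the same as a root of unity of degree 1, so it exists exactly when
  -- the degree map is onto. By the formula for #μ(A), that means an image of order r.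
  · have h1 : (∃ e : L, dot u L e (Conj.conj e) = 1) ↔ Function.Surjective deg := by
      rw [hsurj]
      constructor
      · rintro ⟨e, he⟩
        obtain ⟨ζ, hζ, hζe⟩ := (Set.ext_iff.1 (setOf_dot_eq_one hV hr) e).1 he
        exact ⟨ζ, hζ, e, hζe.symm⟩
      · rintro ⟨ζ, hζ, e, he⟩
        exact ⟨e, (Set.ext_iff.1 (setOf_dot_eq_one hV hr) e).2 ⟨ζ, hζ, he.symm⟩⟩
    rw [h1, hcard, Nat.mul_right_inj hpos.ne', ← MonoidHom.range_eq_top,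
      ← Subgroup.card_eq_iff_eq_top, hZ]
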